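/- Let $\Omega\subset\mathbb R^n$ be a bounded connected open set (no regularity of $\partial\Omega$ is assumed) and let $d(x)=\operatorname{dist}(x,\mathbb R^n\setminus\Omega)-\operatorname{dist}(x,\overline\Omega)$ be the signed distance from $\partial\Omega$. Let $A\subseteq\mathbb R^m$ be closed, let $b:\overline\Omega\times A\to\mathbb R^n$ and $a:\overline\Omega\times A\to\mathbb R^{n\times n}$ be bounded and continuous, and suppose that $a=\sigma\sigma^T$ with $\sigma:\overline\Omega\times A\to\mathbb R^{n\times r}$. Assume that $b$ and $\sigma$ are Lipschitz continuous in $x$ uniformly in $\alpha$: there is $B>0$ with $$|b(x,\alpha)-b(y,\alpha)|\le B|x-y|,\qquad |\sigma(x,\alpha)-\sigma(y,\alpha)|\le B|x-y|\qquad\forall x,y\in\overline\Omega,\ \alpha\in A,$$ where $|\cdot|$ is the Euclidean norm, also for matrices. Put $$F[u](x)=\sup_{\alpha\in A}\bigl(-b(x,\alpha)\cdot Du(x)-\operatorname{tr}(a(x,\alpha)D^2u(x))\bigr).$$ For a set $S\subseteq\mathbb R^n$, $f:S\to\mathbb R$ and $x\in S$, let $J^{2,+}_Sf(x)$ be the set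 of pairs $(p,Y)$, with $p\in\mathbb R^n$ and $Y$ a real symmetric $n\times n$ matrix, such that $$\limsup_{S\ni y\to x}\frac{f(y)-f(x)-p\cdot(y-x)-\frac12 Y(y-x)\cdot(y-x)}{|y-x|^2}\le 0 .$$ A function $u:\Omega\to\mathbb R$ in $USC(\Omega)$ (upper semicontinuous) is a viscosity subsolution of $F[u]=0$ in $\Omega$ if $\sup_{\alpha\in A}(-b(x,\alpha)\cdot p-\operatorname{tr}(a(x,\alpha)X))\le0$ for all $x\in\Omega$ and $(p,X)\in J^{2,+}_\Omega u(x)$. Assume that $F$ satisfies the Strong Maximum Principle in $\Omega$: every viscosity subsolution $v\in USC(\Omega)$ of $F[v]=0$ in $\Omega$ for which there is $x_0\in\Omega$ with $v(x_0)=\max_\Omega v$ is constant. For $z\in\partial\Omega$ let $N(z)$ be the set of unit vectors $\nu$ for which there is $x\in\Omega$ with $x=z+d(x)\nu$. Assume that for every $\overline x\in\partial\Omega$ there are $\overline\alpha\in A$, a neighborhood $U$ of $\overline x$ and $k>0$ such that $$-b(x,\overline\alpha)\cdot p-\operatorname{tr}(a(x,\overline\alpha)Y)\le -k\qquad\forall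 x\in\Omega\cap U,\ \forall (p,Y)\in J^{2,+}_{\overline\Omega}d(x),$$ $$\sigma^T(z,\overline\alpha)\,\nu=0\qquad\forall z\in\partial\Omega\cap U,\ \forall\nu\in N(z).$$ If $u\in USC(\Omega)$ is a viscosity subsolution of $F[u]=0$ in $\Omega$ satisfying $$\limsup_{x\to\partial\Omega}\frac{u(x)}{-\log d(x)}\le 0,$$ then $u$ is constant in $\Omega$. -/

import Mathlib

open Set Filter Topology
open scoped Matrix Matrix.Norms.Frobenius

noncomputable section

/-- The signed distance from the boundary of `Ω`, positive inside `Ω`. -/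
def bdrySignedDist {n : ℕ} (Ω : Set (EuclideanSpace ℝ (Fin n))) (x : EuclideanSpace ℝ (Fin n)) : ℝ :=
  Metric.infDist x Ωᶜ - Metric.infDist x (closure Ω)

/-- The second order superjet `J^{2,+} f(x)` relative to the set `S`: all pairs `(p, Y)` with
`Y` a symmetric matrix and
`limsup (f y - f x - p·(y-x) - (1/2) (y-x)·Y(y-x)) / |y-x|^2 ≤ 0` as `y → x`, `y ∈ S`, `y ≠ x`.
The limsup is taken in the extended reals. -/
def superjet {n : ℕ} (S : Set (EuclideanSpace ℝ (Fin n))) (f : EuclideanSpace ℝ (Fin n) → ℝ)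
    (x : EuclideanSpace ℝ (Fin n)) :
    Set (EuclideanSpace ℝ (Fin n) × Matrix (Fin n) (Fin n) ℝ) :=
  {q | q.2.IsSymm ∧
    limsup (fun y : EuclideanSpace ℝ (Fin n) =>
      (((f y - f x - inner ℝ q.1 (y - x)
          - (1 / 2 : ℝ) * ((y - x).ofLp ⬝ᵥ (q.2 *ᵥ (y - x).ofLp))) / ‖y - x‖ ^ 2 : ℝ) : EReal))
      (𝓝[S \ {x}] x) ≤ 0}

/-- The linear operator for one value of the control, `- b·p - tr (a X)`. -/
def linearPart {n m : ℕ}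
    (b : EuclideanSpace ℝ (Fin n) → EuclideanSpace ℝ (Fin m) → EuclideanSpace ℝ (Fin n))
    (a : EuclideanSpace ℝ (Fin n) → EuclideanSpace ℝ (Fin m) → Matrix (Fin n) (Fin n) ℝ)
    (α : EuclideanSpace ℝ (Fin m)) (x p : EuclideanSpace ℝ (Fin n))
    (X : Matrix (Fin n) (Fin n) ℝ) : ℝ :=
  - inner ℝ (b x α) p - (a x α * X).trace

/-- The Hamilton-Jacobi-Bellman operator `F(x, p, X) = sup_{α ∈ A} (- b(x,α)·p - tr (a(x,α) X))`.
The supremum is finite for bounded coefficients. -/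
def bellman {n m : ℕ} (A : Set (EuclideanSpace ℝ (Fin m)))
    (b : EuclideanSpace ℝ (Fin n) → EuclideanSpace ℝ (Fin m) → EuclideanSpace ℝ (Fin n))
    (a : EuclideanSpace ℝ (Fin n) → EuclideanSpace ℝ (Fin m) → Matrix (Fin n) (Fin n) ℝ)
    (x p : EuclideanSpace ℝ (Fin n)) (X : Matrix (Fin n) (Fin n) ℝ) : ℝ :=
  ⨆ α : A, linearPart b a (α : EuclideanSpace ℝ (Fin m)) x p X

/-- `u` is an upper semicontinuous viscosity subsolution of `F[u] = 0` in `Ω`. -/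
def IsViscositySubsolution {n m : ℕ} (Ω : Set (EuclideanSpace ℝ (Fin n)))
    (A : Set (EuclideanSpace ℝ (Fin m)))
    (b : EuclideanSpace ℝ (Fin n) → EuclideanSpace ℝ (Fin m) → EuclideanSpace ℝ (Fin n))
    (a : EuclideanSpace ℝ (Fin n) → EuclideanSpace ℝ (Fin m) → Matrix (Fin n) (Fin n) ℝ)
    (u : EuclideanSpace ℝ (Fin n) → ℝ) : Prop :=
  UpperSemicontinuousOn u Ω ∧
    ∀ x ∈ Ω, ∀ p : EuclideanSpace ℝ (Fin n), ∀ X : Matrix (Fin n) (Fin n) ℝ,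
      (p, X) ∈ superjet Ω u x → bellman A b a x p X ≤ 0

/-- The Strong Maximum Principle for `F` in `Ω`: an upper semicontinuous viscosity subsolution
of `F[u] = 0` in `Ω` that attains its maximum over `Ω` at a point of `Ω` is constant in `Ω`. -/
def StrongMaximumPrinciple {n m : ℕ} (Ω : Set (EuclideanSpace ℝ (Fin n)))
    (A : Set (EuclideanSpace ℝ (Fin m)))
    (b : EuclideanSpace ℝ (Fin n) → EuclideanSpace ℝ (Fin m) → EuclideanSpace ℝ (Fin n))
    (a : EuclideanSpace ℝ (Fin n) → EuclideanSpace ℝ (Fin m) → Matrix (Fin n) (Fin n) ℝ) : Prop :=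
  ∀ u : EuclideanSpace ℝ (Fin n) → ℝ, IsViscositySubsolution Ω A b a u →
    (∃ x₀ ∈ Ω, IsMaxOn u Ω x₀) → ∃ c : ℝ, ∀ x ∈ Ω, u x = c

/-- The interior (unit) normals to `Ω` at `z`: unit vectors `ν` such that `x = z + d(x) ν` for
some `x ∈ Ω`, where `d` is the distance from the boundary. -/
def interiorNormals {n : ℕ} (Ω : Set (EuclideanSpace ℝ (Fin n))) (z : EuclideanSpace ℝ (Fin n)) :
    Set (EuclideanSpace ℝ (Fin n)) :=
  {ν | ‖ν‖ = 1 ∧ ∃ x ∈ Ω, x = z + bdrySignedDist Ω x • ν}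

/-- The inequality `- b(x,α)·Dd - tr (a(x,α) D²d) ≤ - k` in `Ω ∩ U` in the viscosity sense, where
`d` is the (signed) distance from the boundary. -/
def DistViscosityIneq {n m : ℕ} (Ω U : Set (EuclideanSpace ℝ (Fin n)))
    (b : EuclideanSpace ℝ (Fin n) → EuclideanSpace ℝ (Fin m) → EuclideanSpace ℝ (Fin n))
    (a : EuclideanSpace ℝ (Fin n) → EuclideanSpace ℝ (Fin m) → Matrix (Fin n) (Fin n) ℝ)
    (α : EuclideanSpace ℝ (Fin m)) (k : ℝ) : Prop :=
  ∀ x ∈ Ω ∩ U, ∀ p : EuclideanSpace ℝ (Fin n), ∀ Y : Matrix (Fin n) (Fin n) ℝ,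
    (p, Y) ∈ superjet (closure Ω) (bdrySignedDist Ω) x → linearPart b a α x p Y ≤ -k

/-- The degeneracy condition `σᵀ(z,α) ν = 0` for all `z ∈ ∂Ω ∩ U` and all interior normals `ν`
to `Ω` at `z`. -/
def NormalDegeneracy {n m r : ℕ} (Ω U : Set (EuclideanSpace ℝ (Fin n)))
    (σ : EuclideanSpace ℝ (Fin n) → EuclideanSpace ℝ (Fin m) → Matrix (Fin n) (Fin r) ℝ)
    (α : EuclideanSpace ℝ (Fin m)) : Prop :=
  ∀ z ∈ frontier Ω ∩ U, ∀ ν ∈ interiorNormals Ω z, (σ z α)ᵀ *ᵥ ν.ofLp = 0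

end

/-!
By the strong maximum principle it is enough to show that `u` attains its maximum over `Ω`.

The Lyapunov function is `log d`. If `(q, Y)` is an upper jet of `log d` at `y`, then
`(d q, d (Y + q qᵀ))` is an upper jet of `d` (`UpperJet.of_log`), so the assumption on `d` gives
`b·q + tr (a Y) ≥ k / d - |σᵀ q| ^ 2`. As `σᵀ` vanishes on the normals at the boundary and `σ` is
Lipschitz, `|σᵀ q| ≤ B` (`norm_transpose_mulVec_le`); therefore `b·q + tr (a Y) ≥ 1` in a layer
around the boundary (`log_dist_subsolution`). If `u` exceeded at some point its maximum over
`{d ≥ δ}`, then by the growth condition `u + ε log d` would have, for small `ε`, an interior maximum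
in the layer (`exists_interior_max_add_log`). Since `u` is a subsolution and `log d` a strict
subsolution of the same linear equation, this contradicts local comparison
(`LinearSubsolution.not_strict_max`).

Comparison is proved by doubling the variables. The theorem on sums is needed only for linear
operators, and in this case it has a proof (`LinearSubsolution.add_le`) that avoids the theorems of
Aleksandrov and Jensen. At a maximum of `f₁ x + f₂ y - θ |x - y| ^ 2` both functions are replaced by
sup-convolutions, whose jets are bounded below; this allows the coefficients to be frozen at the
maximum point after adding `δ I` to the diffusion matrices (`LinearSubsolution.eventually_frozen`).
Composed with the affine maps `s ↦ ξ + (σ | √δ I) s`, with the same `s` for both functions, the two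
sup-convolutions satisfy `ΔWᵢ ≥ cᵢ` in the viscosity sense in one Euclidean space
(`exists_upperJet_of_pullback`). Then `W₁ + W₂` cannot touch from below a polynomial with Laplacian
less than `c₁ + c₂` (`ViscLaplacianGe.add_le`): one replaces `W₁` by a polynomial that almost solves
a Dirichlet problem in a ball with boundary values `W₁`, and this gives a smooth test function for
`W₂`. Such polynomials exist by the Stone-Weierstrass theorem and because
`Q ↦ Δ((ρ ^ 2 - |x| ^ 2) Q)` is a bijection on polynomials of bounded degree
(`exists_poly_dirichlet`).
-/

/-! ### Polynomials: Laplacian, Taylor expansion, second derivative test -/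

open MvPolynomial in
/-- The Laplacian of a polynomial in finitely many variables. -/
noncomputable def polyLaplacian {ι : Type*} [Fintype ι] (P : MvPolynomial ι ℝ) : MvPolynomial ι ℝ :=
  ∑ i, pderiv i (pderiv i P)

open MvPolynomial in
/-- The gradient of a polynomial at a point of Euclidean space. -/
noncomputable def polyGrad {ι : Type*} [Fintype ι] (P : MvPolynomial ι ℝ) (x : EuclideanSpace ℝ ι) :
    EuclideanSpace ℝ ι :=
  WithLp.toLp 2 fun i => eval x.ofLp (pderiv i P)

open MvPolynomial in
/-- The Hessian matrix of a polynomial at a point of Euclidean space. -/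
noncomputable def polyHess {ι : Type*} [Fintype ι] (P : MvPolynomial ι ℝ) (x : EuclideanSpace ℝ ι) :
    Matrix ι ι ℝ :=
  Matrix.of fun i j => eval x.ofLp (pderiv i (pderiv j P))

namespace MvPolynomial

theorem pderiv_pderiv_comm {ι : Type*} (i j : ι) (P : MvPolynomial ι ℝ) :
    pderiv i (pderiv j P) = pderiv j (pderiv i P) := by
  classical
  ext m
  simp only [coeff_pderiv]
  by_cases h : i = j
  · subst h; rfl
  · rw [add_right_comm]
    simp [h, Ne.symm h]
    ring

theorem totalDegree_pderiv_le {ι : Type*} (i : ι) (P : MvPolynomial ι ℝ) :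
    (pderiv i P).totalDegree ≤ P.totalDegree - 1 := by
  classical
  rw [totalDegree]
  refine Finset.sup_le fun m hm => ?_
  have h1 : m + Finsupp.single i 1 ∈ P.support := by
    rw [mem_support_iff, coeff_pderiv] at hm
    rw [mem_support_iff]
    exact fun h => hm (by rw [h, zero_mul])
  have h2 := le_totalDegree h1
  rw [Finsupp.sum_add_index' (by simp) (by simp)] at h2
  simp at h2
  omega

end MvPolynomial

section Polynomials
variable {ι : Type*} [Fintype ι]
open MvPolynomial

theorem polyLaplacian_add (P Q : MvPolynomial ι ℝ) :
    polyLaplacian (P + Q) = polyLaplacian P + polyLaplacian Q := by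
  simp [polyLaplacian, Finset.sum_add_distrib]

theorem polyLaplacian_sub (P Q : MvPolynomial ι ℝ) :
    polyLaplacian (P - Q) = polyLaplacian P - polyLaplacian Q := by
  simp [polyLaplacian, Finset.sum_sub_distrib]

theorem polyLaplacian_smul (c : ℝ) (P : MvPolynomial ι ℝ) :
    polyLaplacian (c • P) = c • polyLaplacian P := by
  simp [polyLaplacian, Finset.smul_sum]

theorem polyLaplacian_C (c : ℝ) : polyLaplacian (C c : MvPolynomial ι ℝ) = 0 := by
  simp [polyLaplacian]

theorem polyHess_isSymm (P : MvPolynomial ι ℝ) (x : EuclideanSpace ℝ ι) :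
    (polyHess P x).IsSymm := by
  ext i j
  simp [polyHess, pderiv_pderiv_comm i j]

theorem polyHess_neg (P : MvPolynomial ι ℝ) (x : EuclideanSpace ℝ ι) :
    polyHess (-P) x = -polyHess P x := by
  ext i j
  simp [polyHess]

theorem trace_polyHess (P : MvPolynomial ι ℝ) (x : EuclideanSpace ℝ ι) :
    (polyHess P x).trace = eval x.ofLp (polyLaplacian P) := by
  simp [polyHess, polyLaplacian, Matrix.trace]

omit [Fintype ι] in
theorem continuous_eval_euclidean (P : MvPolynomial ι ℝ) :
    Continuous fun x : EuclideanSpace ℝ ι => eval x.ofLp P :=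
  (continuous_eval P).comp (PiLp.continuous_ofLp 2 _)

theorem polyGrad_mul_X (P : MvPolynomial ι ℝ) (i : ι) (x h : EuclideanSpace ℝ ι) :
    inner ℝ (polyGrad (P * X i) x) h =
      x i * inner ℝ (polyGrad P x) h + h i * eval x.ofLp P := by
  classical
  simp only [polyGrad, PiLp.inner_apply, pderiv_mul, pderiv_X, map_add, map_mul, eval_X,
    RCLike.inner_apply, conj_trivial, mul_add, Finset.sum_add_distrib, Finset.mul_sum]
  congr 1
  · exact Finset.sum_congr rfl fun j _ => by ring
  · rw [Finset.sum_eq_single i] <;> simp +contextual [eq_comm]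

theorem polyHess_mul_X (P : MvPolynomial ι ℝ) (i : ι) (x h : EuclideanSpace ℝ ι) :
    h.ofLp ⬝ᵥ (polyHess (P * X i) x *ᵥ h.ofLp) =
      x i * (h.ofLp ⬝ᵥ (polyHess P x *ᵥ h.ofLp)) + 2 * (h i * inner ℝ (polyGrad P x) h) := by
  classical
  have key : polyHess (P * X i) x = x i • polyHess P x
      + Matrix.vecMulVec (Pi.single i 1) (polyGrad P x).ofLp
      + Matrix.vecMulVec (polyGrad P x).ofLp (Pi.single i 1) := by
    ext j k
    have e : ∀ j, (pderiv j (X i : MvPolynomial ι ℝ)) = C ((Pi.single i (1 : ℝ) : ι → ℝ) j) := by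
      intro j
      by_cases hj : i = j
      · subst hj; simp
      · rw [pderiv_X_of_ne hj]; simp [Ne.symm hj]
    simp only [polyHess, polyGrad, pderiv_mul, map_add, Matrix.of_apply, e, map_mul, eval_X,
      Matrix.add_apply, Matrix.smul_apply, Matrix.vecMulVec_apply, smul_eq_mul, pderiv_C,
      mul_zero, eval_C, map_zero]
    ring
  have h1 : h.ofLp ⬝ᵥ Pi.single i 1 = h i := by simp
  have h2 : (polyGrad P x).ofLp ⬝ᵥ h.ofLp = inner ℝ (polyGrad P x) h := by
    simp [PiLp.inner_apply, dotProduct, mul_comm]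
  rw [key, Matrix.add_mulVec, Matrix.add_mulVec, dotProduct_add, dotProduct_add,
    Matrix.vecMulVec_mulVec, Matrix.vecMulVec_mulVec, Matrix.smul_mulVec, dotProduct_smul]
  simp only [op_smul_eq_smul, dotProduct_smul, h2, smul_eq_mul, dotProduct_comm h.ofLp
      (polyGrad P x).ofLp,
    single_dotProduct, dotProduct_single, one_mul, mul_one]
  ring

theorem abs_apply_le_norm (h : EuclideanSpace ℝ ι) (i : ι) : |h i| ≤ ‖h‖ := by
  simpa using PiLp.norm_apply_le h i

open Asymptotics in
/-- Second order Taylor expansion of a polynomial. -/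
theorem taylor_eval (P : MvPolynomial ι ℝ) (x : EuclideanSpace ℝ ι) :
    (fun h : EuclideanSpace ℝ ι => eval (x + h).ofLp P - (eval x.ofLp P + inner ℝ (polyGrad P x) h
      + (1 / 2 : ℝ) * (h.ofLp ⬝ᵥ (polyHess P x *ᵥ h.ofLp)))) =o[𝓝 0] fun h => ‖h‖ ^ 2 := by
  induction P using MvPolynomial.induction_on with
  | C a =>
    have h1 : polyGrad (C a) x = 0 := by ext i; simp [polyGrad]
    have h2 : polyHess (C a) x = 0 := by ext i j; simp [polyHess]
    simp [h1, h2]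
  | add P Q hP hQ =>
    refine (hP.add hQ).congr_left fun h => ?_
    have h1 : polyGrad (P + Q) x = polyGrad P x + polyGrad Q x := by ext i; simp [polyGrad]
    have h2 : polyHess (P + Q) x = polyHess P x + polyHess Q x := by ext i j; simp [polyHess]
    simp only [h1, h2, inner_add_left, Matrix.add_mulVec, dotProduct_add, map_add]
    ring
  | mul_X P i hP =>
    set q : EuclideanSpace ℝ ι → ℝ := fun h => (1 / 2 : ℝ) * (h.ofLp ⬝ᵥ (polyHess P x *ᵥ h.ofLp))
    have hqO : q =O[𝓝 0] fun h => ‖h‖ ^ 2 := by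
      have : q = fun h => ∑ j, ∑ k, (1 / 2 * polyHess P x j k) * (h j * h k) := by
        funext h
        simp only [q, dotProduct, Matrix.mulVec, Finset.mul_sum]
        exact Finset.sum_congr rfl fun j _ => Finset.sum_congr rfl fun k _ => by ring
      have hjk : ∀ j k, (fun h : EuclideanSpace ℝ ι => h j * h k) =O[𝓝 0] fun h => ‖h‖ ^ 2 := by
        intro j k
        refine IsBigO.of_bound 1 (Eventually.of_forall fun h => ?_)
        rw [one_mul, norm_pow, norm_norm, Real.norm_eq_abs, abs_mul, sq]
        exact mul_le_mul (abs_apply_le_norm h j) (abs_apply_le_norm h k) (abs_nonneg _)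
          (norm_nonneg _)
      rw [this]
      refine IsBigO.fun_sum fun j _ => IsBigO.fun_sum fun k _ => (hjk j k).const_mul_left _
    have hi : Tendsto (fun h : EuclideanSpace ℝ ι => h i) (𝓝 0) (𝓝 0) := by
      have : Continuous fun h : EuclideanSpace ℝ ι => h i := by fun_prop
      simpa using this.tendsto 0
    have h1 : (fun h : EuclideanSpace ℝ ι => (x i + h i) * (eval (x + h).ofLp P -
        (eval x.ofLp P + inner ℝ (polyGrad P x) h + q h))) =o[𝓝 0] fun h => ‖h‖ ^ 2 := by
      have hb : (fun h : EuclideanSpace ℝ ι => x i + h i) =O[𝓝 0] fun _ => (1 : ℝ) :=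
        (tendsto_const_nhds.add hi).isBigO_one ℝ
      simpa only [one_mul] using hb.mul_isLittleO hP
    have h2 : (fun h : EuclideanSpace ℝ ι => h i * q h) =o[𝓝 0] fun h => ‖h‖ ^ 2 := by
      simpa using ((isLittleO_one_iff ℝ).2 hi).mul_isBigO hqO
    refine (h1.add h2).congr_left fun h => ?_
    rw [polyGrad_mul_X, polyHess_mul_X]
    simp only [q, map_mul, eval_X, PiLp.add_apply]
    ring

/-- A quadratic polynomial of one variable without constant term, bounded above by `o(t ^ 2)` at
the origin, has zero slope and nonpositive leading coefficient. -/
theorem slope_eq_zero_and_nonpos {α β : ℝ}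
    (h : ∀ ε > 0, ∀ᶠ t : ℝ in 𝓝 0, t * α + t ^ 2 * β ≤ ε * t ^ 2) : α = 0 ∧ β ≤ 0 := by
  have hα : α = 0 := by
    have hlim : Tendsto (fun t : ℝ => |t| * (1 - β)) (𝓝[≠] 0) (𝓝 0) := by
      have : Continuous fun t : ℝ => |t| * (1 - β) := by fun_prop
      simpa using (this.tendsto 0).mono_left nhdsWithin_le_nhds
    have key : |α| ≤ 0 := by
      refine ge_of_tendsto hlim ?_
      have h1 := h 1 one_pos
      have h2 : ∀ᶠ t : ℝ in 𝓝 0, (-t) * α + (-t) ^ 2 * β ≤ 1 * (-t) ^ 2 :=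
        (show Tendsto (fun t : ℝ => -t) (𝓝 0) (𝓝 0) by
          simpa using (continuous_neg (G := ℝ)).tendsto 0).eventually h1
      filter_upwards [h1.filter_mono nhdsWithin_le_nhds, h2.filter_mono nhdsWithin_le_nhds,
        self_mem_nhdsWithin] with t a b ht
      have ht' : 0 < |t| := abs_pos.2 ht
      have hs : t ^ 2 = |t| ^ 2 := (sq_abs t).symm
      have h3 : |t| * |α| ≤ |t| * (|t| * (1 - β)) := by
        have e : |t| * (|t| * (1 - β)) = t ^ 2 * (1 - β) := by rw [hs]; ring
        rw [← abs_mul, e]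
        refine abs_le.2 ⟨?_, ?_⟩ <;> nlinarith
      exact le_of_mul_le_mul_left h3 ht'
    exact abs_nonpos_iff.1 key
  refine ⟨hα, le_of_forall_pos_le_add fun ε hε => ?_⟩
  obtain ⟨t, ht, ht0⟩ := (((h ε hε).filter_mono nhdsWithin_le_nhds).and
    (self_mem_nhdsWithin : {0}ᶜ ∈ 𝓝[≠] (0 : ℝ))).exists
  have : 0 < t ^ 2 := by have : t ≠ 0 := ht0; positivity
  rw [hα] at ht
  nlinarith

theorem tendsto_line (v : EuclideanSpace ℝ ι) : Tendsto (fun t : ℝ => t • v) (𝓝 0) (𝓝 0) := by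
  have : Continuous fun t : ℝ => t • v := by fun_prop
  simpa using this.tendsto 0

/-- Second derivative test along a line. -/
theorem polyHess_nonpos_of_line_max {P : MvPolynomial ι ℝ} {x v : EuclideanSpace ℝ ι}
    (h : ∀ᶠ t : ℝ in 𝓝 0, eval (x + t • v).ofLp P ≤ eval x.ofLp P) :
    v.ofLp ⬝ᵥ (polyHess P x *ᵥ v.ofLp) ≤ 0 := by
  have key := slope_eq_zero_and_nonpos (α := inner ℝ (polyGrad P x) v)
    (β := (1 / 2 : ℝ) * (v.ofLp ⬝ᵥ (polyHess P x *ᵥ v.ofLp))) ?_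
  · linarith [key.2]
  intro ε hε
  have hc : 0 < ε / (‖v‖ ^ 2 + 1) := by positivity
  filter_upwards [h, (tendsto_line v).eventually ((taylor_eval P x).bound hc)] with t h1 h2
  rw [Real.norm_eq_abs, Real.norm_eq_abs, abs_of_nonneg (sq_nonneg ‖t • v‖), norm_smul, mul_pow,
    Real.norm_eq_abs, sq_abs] at h2
  have h3 := (abs_le.1 h2).1
  simp only [inner_smul_right, WithLp.ofLp_smul, Matrix.mulVec_smul, dotProduct_smul,
    smul_dotProduct, smul_eq_mul] at h3
  have h4 : ε / (‖v‖ ^ 2 + 1) * (t ^ 2 * ‖v‖ ^ 2) ≤ ε * t ^ 2 := by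
    rw [div_mul_eq_mul_div, div_le_iff₀ (by positivity)]
    nlinarith [mul_nonneg hε.le (sq_nonneg t)]
  nlinarith

theorem polyLaplacian_nonpos_of_isLocalMax {P : MvPolynomial ι ℝ} {x : EuclideanSpace ℝ ι}
    (h : IsLocalMax (fun y : EuclideanSpace ℝ ι => eval y.ofLp P) x) :
    eval x.ofLp (polyLaplacian P) ≤ 0 := by
  classical
  rw [← trace_polyHess, Matrix.trace]
  refine Finset.sum_nonpos fun i _ => ?_
  have hd : ∀ M : Matrix ι ι ℝ, M.diag i = (EuclideanSpace.single i (1 : ℝ)).ofLp ⬝ᵥ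
      (M *ᵥ (EuclideanSpace.single i (1 : ℝ)).ofLp) := fun M => by simp
  rw [hd]
  refine polyHess_nonpos_of_line_max ?_
  have hl : Tendsto (fun t : ℝ => x + t • EuclideanSpace.single i (1 : ℝ)) (𝓝 0) (𝓝 x) := by
    have := (tendsto_line (EuclideanSpace.single i (1 : ℝ))).const_add x
    rwa [add_zero] at this
  exact hl.eventually h

end Polynomials

/-! ### The Dirichlet problem for polynomials and comparison for the Laplacian -/

section Dirichlet
variable {ι : Type*} [Fintype ι]
open MvPolynomial

/-- The polynomial `ρ ^ 2 - |x| ^ 2`, which vanishes on the sphere of radius `ρ`. -/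
noncomputable def spherePoly (ι : Type*) [Fintype ι] (ρ : ℝ) : MvPolynomial ι ℝ :=
  C (ρ ^ 2) - ∑ i, X i ^ 2

theorem eval_spherePoly (ρ : ℝ) (x : EuclideanSpace ℝ ι) :
    eval x.ofLp (spherePoly ι ρ) = ρ ^ 2 - ‖x‖ ^ 2 := by
  simp [spherePoly, EuclideanSpace.real_norm_sq_eq]

theorem polyLaplacian_sum_X_sq :
    polyLaplacian (∑ i, X i ^ 2 : MvPolynomial ι ℝ) = C (2 * Fintype.card ι : ℝ) := by
  classical
  have h : ∀ i j : ι, pderiv i (pderiv i (X j ^ 2 : MvPolynomial ι ℝ)) =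
      if j = i then C 2 else 0 := by
    intro i j
    by_cases hij : j = i
    · subst hij
      simp only [pderiv_pow, pderiv_X_self, if_true]
      simp
      rw [show (2 : MvPolynomial ι ℝ) = C 2 from rfl, pderiv_C]
      simp
    · simp [pderiv_X_of_ne hij, hij]
  simp only [polyLaplacian, map_sum, h]
  simp [mul_comm]

theorem polyLaplacian_spherePoly (ρ : ℝ) :
    polyLaplacian (spherePoly ι ρ) = C (-(2 * Fintype.card ι) : ℝ) := by
  rw [spherePoly, polyLaplacian_sub, polyLaplacian_C, polyLaplacian_sum_X_sq, zero_sub, map_neg]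

theorem totalDegree_spherePoly_le (ρ : ℝ) : (spherePoly ι ρ).totalDegree ≤ 2 := by
  rw [spherePoly]
  refine (totalDegree_sub _ _).trans (max_le (by rw [totalDegree_C]; exact Nat.zero_le _) ?_)
  refine totalDegree_finsetSum_le fun i _ => ?_
  simp

theorem totalDegree_polyLaplacian_le (P : MvPolynomial ι ℝ) :
    (polyLaplacian P).totalDegree ≤ P.totalDegree - 2 := by
  refine totalDegree_finsetSum_le fun i _ => ?_
  have h1 := totalDegree_pderiv_le i P
  have h2 := totalDegree_pderiv_le i (pderiv i P)
  omega

/-- `ΔW ≥ c` in the ball of radius `ρ`, in the viscosity sense with polynomial test functions. -/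
def ViscLaplacianGe (ρ c : ℝ) (W : EuclideanSpace ℝ ι → ℝ) : Prop :=
  ∀ s ∈ Metric.ball (0 : EuclideanSpace ℝ ι) ρ, ∀ P : MvPolynomial ι ℝ,
    IsLocalMax (fun y : EuclideanSpace ℝ ι => W y - eval y.ofLp P) s →
      c ≤ eval s.ofLp (polyLaplacian P)

theorem viscLaplacianGe_eval {ρ c : ℝ} {P : MvPolynomial ι ℝ} (hP : polyLaplacian P = C c) :
    ViscLaplacianGe ρ c fun y => eval y.ofLp P := by
  intro s _ Q hQ
  have h := polyLaplacian_nonpos_of_isLocalMax (P := P - Q) (x := s) (by simpa using hQ)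
  rw [polyLaplacian_sub, map_sub, hP, eval_C] at h
  linarith

/-- Comparison of a viscosity subsolution with a strict polynomial supersolution. -/
theorem ViscLaplacianGe.le_eval_add {ρ c ℓ ε : ℝ} {W : EuclideanSpace ℝ ι → ℝ}
    (hW : ViscLaplacianGe ρ c W) (hWc : Continuous W) {P : MvPolynomial ι ℝ}
    (hP : polyLaplacian P = C ℓ) (hℓ : ℓ < c)
    (hs : ∀ s ∈ Metric.sphere (0 : EuclideanSpace ℝ ι) ρ, W s ≤ eval s.ofLp P + ε)
    {s : EuclideanSpace ℝ ι} (hsB : s ∈ Metric.closedBall (0 : EuclideanSpace ℝ ι) ρ) :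
    W s ≤ eval s.ofLp P + ε := by
  obtain ⟨z, hz, hmax⟩ := (isCompact_closedBall (0 : EuclideanSpace ℝ ι) ρ).exists_isMaxOn ⟨s, hsB⟩
    (hWc.sub (continuous_eval_euclidean P)).continuousOn
  rcases (Metric.ball_union_sphere (x := (0 : EuclideanSpace ℝ ι)) (ε := ρ)).symm ▸ hz with
    hz' | hz'
  · have h1 := hW z hz' P
      (hmax.isLocalMax (mem_of_superset (Metric.isOpen_ball.mem_nhds hz')
        Metric.ball_subset_closedBall))
    rw [hP, eval_C] at h1
    linarith
  · have h1 := hs z hz'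
    have h2 : W s - eval s.ofLp P ≤ W z - eval z.ofLp P := hmax hsB
    linarith

/-- A harmonic polynomial that vanishes on a sphere is nonpositive in the ball. -/
theorem eval_nonpos_of_harmonic [Nonempty ι] {ρ : ℝ} {G : MvPolynomial ι ℝ}
    (hG : polyLaplacian G = 0)
    (hs : ∀ s ∈ Metric.sphere (0 : EuclideanSpace ℝ ι) ρ, eval s.ofLp G = 0)
    {s : EuclideanSpace ℝ ι} (hsB : s ∈ Metric.closedBall (0 : EuclideanSpace ℝ ι) ρ) :
    eval s.ofLp G ≤ 0 := by
  have hk : (0 : ℝ) < Fintype.card ι := by exact_mod_cast Fintype.card_pos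
  refine le_of_forall_pos_le_add fun τ hτ => ?_
  have hc : 0 < τ / (ρ ^ 2 + 1) := by positivity
  have h := (viscLaplacianGe_eval (ρ := ρ) (c := 0) (P := G) (by simpa using hG)).le_eval_add
    (continuous_eval_euclidean G) (P := (τ / (ρ ^ 2 + 1)) • spherePoly ι ρ)
    (ℓ := (τ / (ρ ^ 2 + 1)) * (-(2 * Fintype.card ι))) (ε := 0)
    (by rw [polyLaplacian_smul, polyLaplacian_spherePoly, smul_eq_C_mul, C_mul])
    (by nlinarith [mul_pos hc hk]) ?_ hsB
  · refine h.trans ?_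
    rw [smul_eval, eval_spherePoly, add_zero, zero_add, div_mul_eq_mul_div,
      div_le_iff₀ (by positivity)]
    nlinarith [sq_nonneg ‖s‖, mul_nonneg hτ.le (sq_nonneg ‖s‖)]
  · intro z hz
    rw [hs z hz, smul_eval, eval_spherePoly, mem_sphere_zero_iff_norm.1 hz]
    simp

theorem spherePoly_mul_laplacian_injective [Nonempty ι] {ρ : ℝ} (hρ : 0 < ρ) {Q : MvPolynomial ι ℝ}
    (hQ : polyLaplacian (spherePoly ι ρ * Q) = 0) : Q = 0 := by
  have hsph : ∀ s ∈ Metric.sphere (0 : EuclideanSpace ℝ ι) ρ,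
      eval s.ofLp (spherePoly ι ρ * Q) = 0 := by
    intro s hs
    rw [map_mul, eval_spherePoly, mem_sphere_zero_iff_norm.1 hs]
    simp
  have hball : ∀ s ∈ Metric.closedBall (0 : EuclideanSpace ℝ ι) ρ,
      eval s.ofLp (spherePoly ι ρ * Q) = 0 := by
    intro s hs
    refine le_antisymm (eval_nonpos_of_harmonic hQ hsph hs) ?_
    have hneg : polyLaplacian (-(spherePoly ι ρ * Q)) = 0 := by
      rw [← neg_one_smul ℝ, polyLaplacian_smul, hQ, smul_zero]
    have := eval_nonpos_of_harmonic hneg (fun z hz => by rw [map_neg, hsph z hz, neg_zero]) hs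
    rw [map_neg] at this
    linarith
  have hk : (0 : ℝ) < Fintype.card ι := by exact_mod_cast Fintype.card_pos
  set η : ℝ := ρ / (Fintype.card ι + 1)
  have hη : 0 < η := by positivity
  have hzero : spherePoly ι ρ * Q = 0 := by
    refine MvPolynomial.funext_set (s := fun _ => Icc 0 η) (fun _ => Icc_infinite hη) fun x hx => ?_
    rw [map_zero]
    refine hball (WithLp.toLp 2 x) ?_
    rw [mem_closedBall_zero_iff, ← abs_of_pos hρ, ← abs_of_nonneg (norm_nonneg (WithLp.toLp 2 x)),
      ← sq_le_sq, EuclideanSpace.real_norm_sq_eq]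
    calc ∑ i, x i ^ 2 ≤ ∑ _i : ι, η ^ 2 := Finset.sum_le_sum fun i _ =>
          pow_le_pow_left₀ (hx i trivial).1 (hx i trivial).2 2
      _ = Fintype.card ι * η ^ 2 := by simp
      _ ≤ ρ ^ 2 := by
        rw [div_pow, mul_div_assoc', div_le_iff₀ (by positivity)]
        nlinarith [mul_nonneg hk.le (sq_nonneg ρ), mul_nonneg (sq_nonneg (Fintype.card ι : ℝ))
            (sq_nonneg ρ), sq_nonneg ρ]
  refine (mul_eq_zero.1 hzero).resolve_left fun h0 => ?_
  have := eval_spherePoly ρ (0 : EuclideanSpace ℝ ι)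
  rw [h0] at this
  simp at this
  exact hρ.ne' (pow_eq_zero_iff two_ne_zero |>.1 this.symm)

/-- Every polynomial is the Laplacian of a polynomial vanishing on a given sphere: the operator
`Q ↦ Δ((ρ ^ 2 - |x| ^ 2) Q)` does not raise the degree and is injective, so it is surjective on
polynomials of bounded degree. -/
theorem exists_laplacian_spherePoly_mul_eq [Nonempty ι] {ρ : ℝ} (hρ : 0 < ρ)
    (P : MvPolynomial ι ℝ) : ∃ Q, polyLaplacian (spherePoly ι ρ * Q) = P := by
  set N := P.totalDegree
  let T : restrictTotalDegree ι ℝ N →ₗ[ℝ] restrictTotalDegree ι ℝ N :=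
    { toFun := fun Q => ⟨polyLaplacian (spherePoly ι ρ * Q.1), by
        rw [mem_restrictTotalDegree]
        have h1 := totalDegree_polyLaplacian_le (spherePoly ι ρ * Q.1)
        have h2 := totalDegree_mul (spherePoly ι ρ) Q.1
        have h3 := totalDegree_spherePoly_le (ι := ι) ρ
        have h4 := (mem_restrictTotalDegree _ _ _).1 Q.2
        omega⟩
      map_add' := fun Q R => Subtype.ext (by
        simp only [Submodule.coe_add, mul_add, polyLaplacian_add])
      map_smul' := fun c Q => Subtype.ext (by
        simp only [Submodule.coe_smul, mul_smul_comm, polyLaplacian_smul, RingHom.id_apply]) }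
  have hinj : Function.Injective T := by
    rw [injective_iff_map_eq_zero]
    intro Q hQ
    exact Subtype.ext (spherePoly_mul_laplacian_injective hρ (congrArg Subtype.val hQ))
  obtain ⟨Q, hQ⟩ := LinearMap.injective_iff_surjective.1 hinj
    ⟨P, (mem_restrictTotalDegree _ _ _).2 le_rfl⟩
  exact ⟨Q.1, congrArg Subtype.val hQ⟩

/-- Polynomials are dense in the continuous functions on a compact set. -/
theorem exists_poly_near {g : EuclideanSpace ℝ ι → ℝ} (hg : Continuous g)
    {K : Set (EuclideanSpace ℝ ι)} (hK : IsCompact K) {ε : ℝ} (hε : 0 < ε) :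
    ∃ P : MvPolynomial ι ℝ, ∀ x ∈ K, |eval x.ofLp P - g x| < ε := by
  let Φ : MvPolynomial ι ℝ →ₐ[ℝ] C(EuclideanSpace ℝ ι, ℝ) :=
    aeval fun i => ⟨fun x => x i, by fun_prop⟩
  have hΦ : ∀ P x, Φ P x = eval x.ofLp P := by
    intro P x
    induction P using MvPolynomial.induction_on with
    | C a => simp [Φ]
    | add P Q hP hQ => simp [hP, hQ]
    | mul_X P i hP => rw [map_mul, ContinuousMap.mul_apply, hP]; simp [Φ]
  have hsep : Φ.range.SeparatesPoints := by
    intro x y hxy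
    obtain ⟨i, hi⟩ : ∃ i, x i ≠ y i := by
      by_contra! h
      exact hxy (by ext i; exact h i)
    exact ⟨Φ (X i), ⟨Φ (X i), ⟨X i, rfl⟩, rfl⟩, by simpa [hΦ] using hi⟩
  obtain ⟨_, ⟨P, rfl⟩, hP⟩ :=
    ContinuousMap.exists_mem_subalgebra_near_continuous_of_isCompact_of_separatesPoints hsep
      ⟨g, hg⟩ hK hε
  exact ⟨P, fun x hx => by simpa [hΦ] using hP x hx⟩

/-- Approximate solution of the Dirichlet problem `Δh = c` in a ball, by a polynomial. -/
theorem exists_poly_dirichlet [Nonempty ι] {g : EuclideanSpace ℝ ι → ℝ} (hg : Continuous g)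
    {ρ : ℝ} (hρ : 0 < ρ) (c : ℝ) {ε : ℝ} (hε : 0 < ε) :
    ∃ P : MvPolynomial ι ℝ, polyLaplacian P = C c ∧
      ∀ s ∈ Metric.sphere (0 : EuclideanSpace ℝ ι) ρ, |eval s.ofLp P - g s| < ε := by
  obtain ⟨P, hP⟩ := exists_poly_near hg (isCompact_sphere (0 : EuclideanSpace ℝ ι) ρ) hε
  obtain ⟨Q, hQ⟩ := exists_laplacian_spherePoly_mul_eq hρ (polyLaplacian P - C c)
  refine ⟨P - spherePoly ι ρ * Q, ?_, fun s hs => ?_⟩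
  · rw [polyLaplacian_sub, hQ, sub_sub_cancel]
  · rw [map_sub, map_mul, eval_spherePoly, mem_sphere_zero_iff_norm.1 hs]
    simpa using hP s hs

/-- If the sum of two functions touches from below, at the centre of a ball, a polynomial with
constant Laplacian `ℓ`, then `ℓ` is at least the sum of the viscosity lower bounds for their
Laplacians. One of the two functions is replaced by the solution of a Dirichlet problem, which is
a smooth test function for the other. -/
theorem ViscLaplacianGe.add_le [Nonempty ι] {ρ c₁ c₂ ℓ : ℝ} (hρ : 0 < ρ)
    {W₁ W₂ : EuclideanSpace ℝ ι → ℝ} (h₁ : ViscLaplacianGe ρ c₁ W₁) (h₂ : ViscLaplacianGe ρ c₂ W₂)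
    (hc₁ : Continuous W₁) (hc₂ : Continuous W₂) {Q : MvPolynomial ι ℝ} (hQ : polyLaplacian Q = C ℓ)
    (hle : ∀ s, W₁ s + W₂ s ≤ eval s.ofLp Q)
    (heq : W₁ 0 + W₂ 0 = eval (0 : EuclideanSpace ℝ ι).ofLp Q) : c₁ + c₂ ≤ ℓ := by
  by_contra! hlt
  have hk : (0 : ℝ) < Fintype.card ι := by exact_mod_cast Fintype.card_pos
  set k : ℝ := (Fintype.card ι : ℝ)
  obtain ⟨τ, hτ, hτl⟩ : ∃ τ : ℝ, 0 < τ ∧ ℓ + 3 * τ = c₁ + c₂ :=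
    ⟨(c₁ + c₂ - ℓ) / 3, by linarith, by ring⟩
  obtain ⟨ε, hε, hεl⟩ : ∃ ε : ℝ, 0 < ε ∧ 3 * ε = τ / (2 * k) * ρ ^ 2 :=
    ⟨τ / (2 * k) * ρ ^ 2 / 3, by positivity, by ring⟩
  -- `P + ε` lies above `W₁`, so `Q - P` lies above `W₂` up to `ε` on the sphere; the Laplacian of
  -- `Q - P` is below `c₂` by `2 τ`, which leaves room to push the test function down at the centre.
  obtain ⟨P, hP, hPs⟩ := exists_poly_dirichlet hc₁ hρ (c₁ - τ) hε
  have hB : (0 : EuclideanSpace ℝ ι) ∈ Metric.closedBall (0 : EuclideanSpace ℝ ι) ρ := by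
    simpa using hρ.le
  have e₁ := h₁.le_eval_add hc₁ hP (by linarith) (ε := ε)
    (fun s hs => by linarith [(abs_lt.1 (hPs s hs)).1]) hB
  have e₂ := h₂.le_eval_add hc₂ (P := Q - P - (τ / (2 * k)) • spherePoly ι ρ)
    (ℓ := ℓ - (c₁ - τ) + τ) (ε := ε) ?_ (by linarith) ?_ hB
  · rw [map_sub, map_sub, smul_eval, eval_spherePoly, norm_zero] at e₂
    linarith
  · rw [polyLaplacian_sub, polyLaplacian_sub, hQ, hP, polyLaplacian_smul,
      polyLaplacian_spherePoly, smul_eq_C_mul, ← C_mul, ← C_sub, ← C_sub]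
    congr 1
    change _ - τ / (2 * k) * -(2 * k) = _
    field_simp
    ring
  · intro s hs
    rw [map_sub, map_sub, smul_eval, eval_spherePoly, mem_sphere_zero_iff_norm.1 hs]
    linarith [hle s, (abs_lt.1 (hPs s hs)).2]

end Dirichlet

/-! ### Upper jets and sup-convolution -/

section MatrixFacts

theorem norm_toLp_mulVec_le {ι κ : Type*} [Fintype ι] [Fintype κ] (M : Matrix ι κ ℝ) (v : κ → ℝ) :
    ‖WithLp.toLp 2 (M *ᵥ v)‖ ≤ ‖M‖ * ‖WithLp.toLp 2 v‖ := by
  rw [← Matrix.frobenius_norm_replicateCol (ι := Unit), ← Matrix.frobenius_norm_replicateCol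
    (ι := Unit) v, Matrix.replicateCol_mulVec]
  exact Matrix.frobenius_norm_mul _ _

theorem inner_eq_dotProduct {ι : Type*} [Fintype ι] (x y : EuclideanSpace ℝ ι) :
    inner ℝ x y = x.ofLp ⬝ᵥ y.ofLp := by
  simp [EuclideanSpace.inner_eq_star_dotProduct, dotProduct_comm]

theorem dotProduct_self_eq_norm_sq {ι : Type*} [Fintype ι] (v : ι → ℝ) :
    v ⬝ᵥ v = ‖WithLp.toLp 2 v‖ ^ 2 := by
  rw [← real_inner_self_eq_norm_sq, inner_eq_dotProduct]

theorem abs_dotProduct_mulVec_le {ι : Type*} [Fintype ι] (M : Matrix ι ι ℝ) (v : ι → ℝ) :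
    |v ⬝ᵥ (M *ᵥ v)| ≤ ‖M‖ * ‖WithLp.toLp 2 v‖ ^ 2 := by
  have h := abs_real_inner_le_norm (WithLp.toLp 2 v) (WithLp.toLp 2 (M *ᵥ v))
  rw [inner_eq_dotProduct] at h
  refine h.trans ?_
  nlinarith [norm_toLp_mulVec_le M v, norm_nonneg (WithLp.toLp 2 v)]

theorem trace_vecMulVec_mul {ι : Type*} [Fintype ι] (v w : ι → ℝ) (N : Matrix ι ι ℝ) :
    (Matrix.vecMulVec v w * N).trace = w ⬝ᵥ (N *ᵥ v) := by
  rw [Matrix.vecMulVec_mul, Matrix.trace_vecMulVec, dotProduct_comm, Matrix.dotProduct_mulVec]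

theorem trace_mul_nonneg_of_posSemidef {ι : Type*} [Fintype ι] {M N : Matrix ι ι ℝ}
    (hM : M.PosSemidef) (hN : ∀ v, 0 ≤ v ⬝ᵥ (N *ᵥ v)) : 0 ≤ (M * N).trace := by
  obtain ⟨m, w, rfl⟩ := Matrix.posSemidef_iff_eq_sum_vecMulVec.1 hM
  rw [Finset.sum_mul, Matrix.trace_sum]
  refine Finset.sum_nonneg fun i _ => ?_
  rw [trace_vecMulVec_mul, star_trivial]
  exact hN _

theorem posSemidef_mul_transpose {ι κ : Type*} [Fintype ι] [Fintype κ] (M : Matrix ι κ ℝ) :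
    (M * Mᵀ).PosSemidef := by
  simpa using Matrix.posSemidef_self_mul_conjTranspose M

end MatrixFacts

/-- One-sided second order expansions: `(p, X)` is an upper jet of `f` at `x` when
`f (x + h) ≤ f x + p·h + (1/2) h·Xh + o(|h| ^ 2)` as `h → 0`. Only the values of `f` near `x` matter,
so at interior points of a set this is the superjet relative to the set. -/
def UpperJet {n : ℕ} (f : EuclideanSpace ℝ (Fin n) → ℝ) (x p : EuclideanSpace ℝ (Fin n))
    (X : Matrix (Fin n) (Fin n) ℝ) : Prop :=
  ∀ ε > 0, ∀ᶠ h : EuclideanSpace ℝ (Fin n) in 𝓝 0,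
    f (x + h) ≤ f x + inner ℝ p h + (1 / 2 : ℝ) * (h.ofLp ⬝ᵥ (X *ᵥ h.ofLp)) + ε * ‖h‖ ^ 2

section Jets
variable {n : ℕ}

theorem UpperJet.mem_superjet {f : EuclideanSpace ℝ (Fin n) → ℝ} {x p : EuclideanSpace ℝ (Fin n)}
    {X : Matrix (Fin n) (Fin n) ℝ}
    (h : UpperJet f x p X) (hX : X.IsSymm) (S : Set (EuclideanSpace ℝ (Fin n))) :
    (p, X) ∈ superjet S f x := by
  refine ⟨hX, ?_⟩
  refine le_of_forall_gt_imp_ge_of_dense fun c hc => ?_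
  obtain ⟨ε, hε0, hεc⟩ := EReal.lt_iff_exists_real_btwn.1 hc
  have hε : 0 < ε := by exact_mod_cast hε0
  refine le_trans ?_ hεc.le
  refine limsup_le_of_le (by isBoundedDefault) ?_
  have hsub : Tendsto (fun y : EuclideanSpace ℝ (Fin n) => y - x) (𝓝[S \ {x}] x) (𝓝 0) := by
    have : Continuous fun y : EuclideanSpace ℝ (Fin n) => y - x := by fun_prop
    simpa using (this.tendsto x).mono_left nhdsWithin_le_nhds
  filter_upwards [hsub.eventually (h ε hε), self_mem_nhdsWithin] with y hy hyS
  have hne : y - x ≠ 0 := sub_ne_zero.2 hyS.2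
  have hpos : 0 < ‖y - x‖ ^ 2 := by positivity
  rw [add_sub_cancel] at hy
  rw [EReal.coe_le_coe_iff, div_le_iff₀ hpos]
  linarith

theorem UpperJet.congr_of_le {f g : EuclideanSpace ℝ (Fin n) → ℝ} {x p : EuclideanSpace ℝ (Fin n)}
    {X : Matrix (Fin n) (Fin n) ℝ}
    (h : UpperJet f x p X) {y : EuclideanSpace ℝ (Fin n)}
    (hle : ∀ᶠ k in 𝓝 (0 : EuclideanSpace ℝ (Fin n)), g (y + k) - g y ≤ f (x + k) - f x) :
    UpperJet g y p X := by
  intro ε hε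
  filter_upwards [h ε hε, hle] with k h1 h2
  linarith

/-- A function that is also bounded below by a paraboloid of opening `lam` has its upper jets
determined to first order and bounded below to second order. -/
theorem UpperJet.eq_and_ge {f : EuclideanSpace ℝ (Fin n) → ℝ} {x p q : EuclideanSpace ℝ (Fin n)}
    {X : Matrix (Fin n) (Fin n) ℝ} {lam : ℝ}
    (h : UpperJet f x p X)
    (hlow : ∀ᶠ k in 𝓝 (0 : EuclideanSpace ℝ (Fin n)), f x + inner ℝ q k - lam * ‖k‖ ^ 2 ≤ f (x + k))
    :
    p = q ∧ ∀ v : Fin n → ℝ, 0 ≤ v ⬝ᵥ ((X + (2 * lam) • (1 : Matrix (Fin n) (Fin n) ℝ)) *ᵥ v) := by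
  have key : ∀ v : EuclideanSpace ℝ (Fin n), inner ℝ (q - p) v = 0 ∧
      -lam * ‖v‖ ^ 2 - (1 / 2 : ℝ) * (v.ofLp ⬝ᵥ (X *ᵥ v.ofLp)) ≤ 0 := by
    intro v
    refine slope_eq_zero_and_nonpos fun ε hε => ?_
    have hc : 0 < ε / (‖v‖ ^ 2 + 1) := by positivity
    filter_upwards [(tendsto_line v).eventually (h _ hc), (tendsto_line v).eventually hlow]
      with t h1 h2
    have h3 := h2.trans h1
    simp only [inner_smul_right, WithLp.ofLp_smul, Matrix.mulVec_smul, dotProduct_smul,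
      smul_dotProduct, smul_eq_mul, norm_smul, mul_pow, Real.norm_eq_abs, sq_abs] at h3
    have h4 : ε / (‖v‖ ^ 2 + 1) * (t ^ 2 * ‖v‖ ^ 2) ≤ ε * t ^ 2 := by
      rw [div_mul_eq_mul_div, div_le_iff₀ (by positivity)]
      nlinarith [mul_nonneg hε.le (sq_nonneg t)]
    rw [inner_sub_left]
    nlinarith
  refine ⟨?_, fun v => ?_⟩
  · have := (key (q - p)).1
    rw [inner_self_eq_zero, sub_eq_zero] at this
    exact this.symm
  · have := (key (WithLp.toLp 2 v)).2
    rw [Matrix.add_mulVec, dotProduct_add, Matrix.smul_mulVec, Matrix.one_mulVec, dotProduct_smul,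
      smul_eq_mul, dotProduct_self_eq_norm_sq]
    simp only at this
    linarith

/-- `S` selects, for every `ξ`, a point of `K` at which `f - lam * |· - ξ| ^ 2` attains its maximum
over `K`. -/
def IsSupConvSelection (K : Set (EuclideanSpace ℝ (Fin n))) (f : EuclideanSpace ℝ (Fin n) → ℝ)
    (lam : ℝ) (S : EuclideanSpace ℝ (Fin n) → EuclideanSpace ℝ (Fin n)) : Prop :=
  ∀ ξ, S ξ ∈ K ∧ IsMaxOn (fun x => f x - lam * ‖x - ξ‖ ^ 2) K (S ξ)

/-- The sup-convolution of `f` over `K`, written by means of a selection of maximizers. -/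
noncomputable def supConv (f : EuclideanSpace ℝ (Fin n) → ℝ) (lam : ℝ)
    (S : EuclideanSpace ℝ (Fin n) → EuclideanSpace ℝ (Fin n)) (ξ : EuclideanSpace ℝ (Fin n)) : ℝ :=
  f (S ξ) - lam * ‖S ξ - ξ‖ ^ 2

theorem exists_isSupConvSelection {K : Set (EuclideanSpace ℝ (Fin n))} (hK : IsCompact K)
    (hne : K.Nonempty) {f : EuclideanSpace ℝ (Fin n) → ℝ}
    (hf : UpperSemicontinuousOn f K) (lam : ℝ) : ∃ S, IsSupConvSelection K f lam S := by
  have h : ∀ ξ : EuclideanSpace ℝ (Fin n),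
      ∃ z ∈ K, IsMaxOn (fun x => f x - lam * ‖x - ξ‖ ^ 2) K z := by
    intro ξ
    refine UpperSemicontinuousOn.exists_isMaxOn hne hK ?_
    have hc : ContinuousOn (fun x : EuclideanSpace ℝ (Fin n) => -(lam * ‖x - ξ‖ ^ 2)) K := by
      fun_prop
    simpa [sub_eq_add_neg] using hf.add hc.upperSemicontinuousOn
  choose S h1 h2 using h
  exact ⟨S, fun ξ => ⟨h1 ξ, h2 ξ⟩⟩

namespace IsSupConvSelection
variable {K : Set (EuclideanSpace ℝ (Fin n))} {f : EuclideanSpace ℝ (Fin n) → ℝ} {lam : ℝ}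
    {S : EuclideanSpace ℝ (Fin n) → EuclideanSpace ℝ (Fin n)}

theorem le_supConv (hS : IsSupConvSelection K f lam S) {x : EuclideanSpace ℝ (Fin n)} (hx : x ∈ K)
    (ξ : EuclideanSpace ℝ (Fin n)) :
    f x - lam * ‖x - ξ‖ ^ 2 ≤ supConv f lam S ξ :=
  (hS ξ).2 hx

theorem paraboloid_le (hS : IsSupConvSelection K f lam S) (ξ k : EuclideanSpace ℝ (Fin n)) :
    supConv f lam S ξ + inner ℝ ((2 * lam) • (S ξ - ξ)) k - lam * ‖k‖ ^ 2 ≤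
      supConv f lam S (ξ + k) := by
  refine le_trans (le_of_eq ?_) (hS.le_supConv (hS ξ).1 (ξ + k))
  rw [supConv, ← sub_sub, norm_sub_sq_real (S ξ - ξ) k, inner_smul_left]
  simp
  ring

theorem continuous_supConv (hS : IsSupConvSelection K f lam S) (hlam : 0 ≤ lam)
    (hK : Bornology.IsBounded K) : Continuous (supConv f lam S) := by
  obtain ⟨R, hR⟩ := hK.exists_norm_le
  have hlow : ∀ ξ k : EuclideanSpace ℝ (Fin n), supConv f lam S ξ - supConv f lam S (ξ + k) ≤
      2 * lam * ((R + ‖ξ‖) * ‖k‖) + lam * ‖k‖ ^ 2 := by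
    intro ξ k
    have h1 := hS.paraboloid_le ξ k
    have h2 : -inner ℝ ((2 * lam) • (S ξ - ξ)) k ≤ 2 * lam * ((R + ‖ξ‖) * ‖k‖) := by
      rw [inner_smul_left, conj_trivial, ← mul_neg, ← inner_neg_left]
      refine mul_le_mul_of_nonneg_left ((real_inner_le_norm _ _).trans ?_) (by positivity)
      rw [norm_neg]
      exact mul_le_mul_of_nonneg_right
        ((norm_sub_le _ _).trans (add_le_add_left (hR _ (hS ξ).1) _)) (norm_nonneg _)
    linarith
  rw [continuous_iff_continuousAt]
  intro ξ
  have hlim : Tendsto (fun η : EuclideanSpace ℝ (Fin n) =>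
      2 * lam * ((R + ‖ξ‖ + ‖η - ξ‖) * ‖η - ξ‖) + lam * ‖η - ξ‖ ^ 2) (𝓝 ξ) (𝓝 0) := by
    have : Continuous fun η : EuclideanSpace ℝ (Fin n) =>
      2 * lam * ((R + ‖ξ‖ + ‖η - ξ‖) * ‖η - ξ‖) + lam * ‖η - ξ‖ ^ 2 := by fun_prop
    simpa using this.tendsto ξ
  refine tendsto_iff_norm_sub_tendsto_zero.2
      (squeeze_zero (fun _ => norm_nonneg _) (fun η => ?_) hlim)
  rw [Real.norm_eq_abs, abs_le]
  have h1 := hlow ξ (η - ξ)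
  have h2 := hlow η (ξ - η)
  rw [add_sub_cancel] at h1 h2
  rw [norm_sub_rev ξ η] at h2
  have h3 : ‖η‖ ≤ ‖ξ‖ + ‖η - ξ‖ := by
    simpa using norm_add_le ξ (η - ξ)
  have h4 : 2 * lam * ((R + ‖η‖) * ‖η - ξ‖) ≤ 2 * lam * ((R + ‖ξ‖ + ‖η - ξ‖) * ‖η - ξ‖) :=
    mul_le_mul_of_nonneg_left (mul_le_mul_of_nonneg_right (by linarith) (norm_nonneg _))
      (by positivity)
  have h5 : 2 * lam * ((R + ‖ξ‖) * ‖η - ξ‖) ≤ 2 * lam * ((R + ‖ξ‖ + ‖η - ξ‖) * ‖η - ξ‖) :=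
    mul_le_mul_of_nonneg_left (mul_le_mul_of_nonneg_right (by linarith [norm_nonneg (η - ξ)])
      (norm_nonneg _)) (by positivity)
  constructor <;> linarith

/-- Upper jets of a sup-convolution are upper jets of the function at the maximizer, their first
order part is explicit and their second order part is bounded below. -/
theorem upperJet (hS : IsSupConvSelection K f lam S) {ξ p : EuclideanSpace ℝ (Fin n)}
    {X : Matrix (Fin n) (Fin n) ℝ}
    (h : UpperJet (supConv f lam S) ξ p X) (hint : S ξ ∈ interior K) :
    UpperJet f (S ξ) p X ∧ p = (2 * lam) • (S ξ - ξ) ∧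
      ∀ v : Fin n → ℝ, 0 ≤ v ⬝ᵥ ((X + (2 * lam) • (1 : Matrix (Fin n) (Fin n) ℝ)) *ᵥ v) := by
  refine ⟨h.congr_of_le ?_, h.eq_and_ge (Eventually.of_forall fun k => hS.paraboloid_le ξ k)⟩
  have hlim : Tendsto (fun k : EuclideanSpace ℝ (Fin n) => S ξ + k) (𝓝 0) (𝓝 (S ξ)) := by
    have : Continuous fun k : EuclideanSpace ℝ (Fin n) => S ξ + k := by fun_prop
    simpa using this.tendsto 0
  filter_upwards [hlim.eventually (mem_interior_iff_mem_nhds.1 hint)] with k hk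
  have h1 := hS.le_supConv hk (ξ + k)
  rw [add_sub_add_right_eq_sub] at h1
  simp only [supConv] at h1 ⊢
  linarith

end IsSupConvSelection

/-- `tr (σ σᵀ X) + b·p ≥ κ` for all upper jets of `f` at points of `V`: the function `f` is a
viscosity subsolution of a linear degenerate elliptic equation. -/
def LinearSubsolution {r : ℕ} (V : Set (EuclideanSpace ℝ (Fin n)))
    (b : EuclideanSpace ℝ (Fin n) → EuclideanSpace ℝ (Fin n))
    (σ : EuclideanSpace ℝ (Fin n) → Matrix (Fin n) (Fin r) ℝ) (κ : ℝ)
    (f : EuclideanSpace ℝ (Fin n) → ℝ) : Prop :=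
  ∀ x ∈ V, ∀ (p : EuclideanSpace ℝ (Fin n)) (X : Matrix (Fin n) (Fin n) ℝ), X.IsSymm →
    UpperJet f x p X → κ ≤ inner ℝ (b x) p + (σ x * (σ x)ᵀ * X).trace

/-- Sup-convolution freezes the coefficients: near a point `ξ₀` with unique maximizer `x₀`, the
upper jets of the sup-convolution satisfy an inequality with the coefficients taken at `x₀`, once
the diffusion matrix is increased by `δ`. This uses the lower bound `-2 lam` for the second order
part of the jets to absorb the variation of the diffusion matrix. -/
theorem LinearSubsolution.eventually_frozen {r : ℕ} {K : Set (EuclideanSpace ℝ (Fin n))}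
    {f : EuclideanSpace ℝ (Fin n) → ℝ} {lam κ δ C : ℝ}
    {S : EuclideanSpace ℝ (Fin n) → EuclideanSpace ℝ (Fin n)}
    {b : EuclideanSpace ℝ (Fin n) → EuclideanSpace ℝ (Fin n)}
    {σ : EuclideanSpace ℝ (Fin n) → Matrix (Fin n) (Fin r) ℝ} {x₀ ξ₀ : EuclideanSpace ℝ (Fin n)}
    (hf : LinearSubsolution (interior K) b σ κ f) (hS : IsSupConvSelection K f lam S)
    (hx₀ : x₀ ∈ interior K) (hlip : ∀ ξ, ‖S ξ - x₀‖ ≤ C * ‖ξ - ξ₀‖)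
    (hb : ContinuousAt b x₀) (hσ : ContinuousAt σ x₀) (hδ : 0 < δ) :
    ∀ᶠ ξ in 𝓝 ξ₀, ∀ (p : EuclideanSpace ℝ (Fin n)) (X : Matrix (Fin n) (Fin n) ℝ), X.IsSymm →
      UpperJet (supConv f lam S) ξ p X →
        κ - inner ℝ (b x₀) ((2 * lam) • (x₀ - ξ₀)) - 2 * lam * n * δ - δ ≤
          ((σ x₀ * (σ x₀)ᵀ + δ • (1 : Matrix (Fin n) (Fin n) ℝ)) * X).trace := by
  have hS₀ : S ξ₀ = x₀ := by
    have := hlip ξ₀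
    rw [sub_self, norm_zero, mul_zero] at this
    exact sub_eq_zero.1 (norm_le_zero_iff.1 this)
  have hSlim : Tendsto S (𝓝 ξ₀) (𝓝 x₀) := by
    have hc : Continuous fun ξ : EuclideanSpace ℝ (Fin n) => C * ‖ξ - ξ₀‖ := by fun_prop
    refine tendsto_iff_norm_sub_tendsto_zero.2 (squeeze_zero (fun _ => norm_nonneg _) hlip ?_)
    simpa using hc.tendsto ξ₀
  have hσS : Tendsto (fun ξ => σ (S ξ)) (𝓝 ξ₀) (𝓝 (σ x₀)) := hσ.tendsto.comp hSlim
  have haS : Tendsto (fun ξ => σ (S ξ) * (σ (S ξ))ᵀ) (𝓝 ξ₀) (𝓝 (σ x₀ * (σ x₀)ᵀ)) :=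
    ((continuous_id.matrix_mul continuous_id.matrix_transpose).tendsto (σ x₀)).comp hσS
  have hbS : Tendsto (fun ξ => inner ℝ (b (S ξ)) ((2 * lam) • (S ξ - ξ))) (𝓝 ξ₀)
      (𝓝 (inner ℝ (b x₀) ((2 * lam) • (x₀ - ξ₀)))) :=
    (hb.tendsto.comp hSlim).inner ((hSlim.sub tendsto_id).const_smul _)
  have htr : Tendsto (fun ξ => (σ (S ξ) * (σ (S ξ))ᵀ).trace) (𝓝 ξ₀)
      (𝓝 (σ x₀ * (σ x₀)ᵀ).trace) :=
    (continuous_id.matrix_trace.tendsto (σ x₀ * (σ x₀)ᵀ)).comp haS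
  have hψ := hbS.sub (htr.const_mul (2 * lam))
  have hnear : ∀ᶠ ξ in 𝓝 ξ₀, ‖σ (S ξ) * (σ (S ξ))ᵀ - σ x₀ * (σ x₀)ᵀ‖ < δ := by
    have := (tendsto_iff_norm_sub_tendsto_zero.1 haS)
    exact this.eventually (gt_mem_nhds hδ)
  filter_upwards [hnear, hSlim.eventually (isOpen_interior.mem_nhds hx₀),
    hψ.eventually (gt_mem_nhds (lt_add_of_pos_right _ hδ))] with ξ h1 h2 h3 p X hX hjet
  obtain ⟨hj, hp, hX0⟩ := hS.upperJet hjet h2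
  have h4 := hf _ h2 p X hX hj
  rw [hp] at h4
  set a₀ := σ x₀ * (σ x₀)ᵀ
  set a := σ (S ξ) * (σ (S ξ))ᵀ
  have hM : (a₀ + δ • (1 : Matrix (Fin n) (Fin n) ℝ) - a).PosSemidef := by
    refine Matrix.PosSemidef.of_dotProduct_mulVec_nonneg ?_ fun v => ?_
    · refine ((posSemidef_mul_transpose (σ x₀)).1.add ?_).sub (posSemidef_mul_transpose _).1
      simp [Matrix.IsHermitian]
    · have h5 := (abs_le.1 (abs_dotProduct_mulVec_le (a - a₀) v)).2
      rw [star_trivial, show a₀ + δ • (1 : Matrix (Fin n) (Fin n) ℝ) - a = δ • 1 - (a - a₀) by abel,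
        Matrix.sub_mulVec, dotProduct_sub, Matrix.smul_mulVec, Matrix.one_mulVec, dotProduct_smul,
        smul_eq_mul, dotProduct_self_eq_norm_sq]
      nlinarith [sq_nonneg ‖WithLp.toLp 2 v‖]
  -- Both factors are positive semidefinite: this replaces an upper bound on `X`, which is missing.
  have h6 := trace_mul_nonneg_of_posSemidef hM hX0
  have e1 : ((a₀ + δ • (1 : Matrix (Fin n) (Fin n) ℝ) - a) *
      (X + (2 * lam) • (1 : Matrix (Fin n) (Fin n) ℝ))).trace =
      ((a₀ + δ • (1 : Matrix (Fin n) (Fin n) ℝ)) * X).trace - (a * X).trace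
        + 2 * lam * (a₀.trace + δ * n - a.trace) := by
    rw [mul_add, Matrix.trace_add, sub_mul, Matrix.trace_sub, Matrix.mul_smul, mul_one,
      Matrix.trace_smul, Matrix.trace_sub, Matrix.trace_add, Matrix.trace_smul, Matrix.trace_one]
    simp
  rw [e1] at h6
  linarith

end Jets

/-! ### Change of variables in jets -/

section Pullback
variable {n : ℕ} {κ : Type*} [Fintype κ]
open MvPolynomial

/-- The affine map `s ↦ ξ + L s` between Euclidean spaces. -/
noncomputable def affineMap (L : Matrix (Fin n) κ ℝ) (ξ : EuclideanSpace ℝ (Fin n))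
    (s : EuclideanSpace ℝ κ) : EuclideanSpace ℝ (Fin n) :=
  ξ + WithLp.toLp 2 (L *ᵥ s.ofLp)

theorem continuous_affineMap (L : Matrix (Fin n) κ ℝ) (ξ : EuclideanSpace ℝ (Fin n)) :
    Continuous (affineMap L ξ) := by
  unfold affineMap
  fun_prop

theorem affineMap_zero (L : Matrix (Fin n) κ ℝ) (ξ : EuclideanSpace ℝ (Fin n)) :
    affineMap L ξ 0 = ξ := by
  simp [affineMap]

theorem affineMap_add (L : Matrix (Fin n) κ ℝ) (ξ : EuclideanSpace ℝ (Fin n))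
    (s t : EuclideanSpace ℝ κ) :
    affineMap L ξ (s + t) = affineMap L ξ s + WithLp.toLp 2 (L *ᵥ t.ofLp) := by
  simp [affineMap, Matrix.mulVec_add, add_assoc]

theorem taylor_eval_le (P : MvPolynomial κ ℝ) (x : EuclideanSpace ℝ κ) {ε : ℝ} (hε : 0 < ε) :
    ∀ᶠ h : EuclideanSpace ℝ κ in 𝓝 0, eval (x + h).ofLp P ≤ eval x.ofLp P +
      inner ℝ (polyGrad P x) h + (1 / 2 : ℝ) * (h.ofLp ⬝ᵥ (polyHess P x *ᵥ h.ofLp))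
        + ε * ‖h‖ ^ 2 := by
  filter_upwards [(taylor_eval P x).bound hε] with h hh
  rw [Real.norm_eq_abs, norm_pow, norm_norm] at hh
  linarith [(abs_le.1 hh).2]

/-- A polynomial touching the pullback of `f` under the surjective affine map `s ↦ ξ + L s` from
above yields an upper jet of `f`, along the pseudo-inverse `Lᵀ (L Lᵀ)⁻¹` of `L`. The pullback is
constant along the kernel of `L`, where the Hessian of the polynomial is therefore nonnegative, so
`tr (L Lᵀ X)` is at most the full Laplacian of the polynomial. -/
theorem exists_upperJet_of_pullback {f : EuclideanSpace ℝ (Fin n) → ℝ}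
    {ξ : EuclideanSpace ℝ (Fin n)} {L : Matrix (Fin n) κ ℝ} (hL : IsUnit (L * Lᵀ).det)
    {P : MvPolynomial κ ℝ} {s : EuclideanSpace ℝ κ}
    (hmax : IsLocalMax (fun t : EuclideanSpace ℝ κ => f (affineMap L ξ t) - eval t.ofLp P) s) :
    ∃ p X, X.IsSymm ∧ UpperJet f (affineMap L ξ s) p X ∧
      (L * Lᵀ * X).trace ≤ eval s.ofLp (polyLaplacian P) := by
  classical
  set G := L * Lᵀ with hG
  have hGsymm : Gᵀ = G := by rw [hG, Matrix.transpose_mul, Matrix.transpose_transpose]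
  have hGinv : (G⁻¹)ᵀ = G⁻¹ := by rw [Matrix.transpose_nonsing_inv, hGsymm]
  set T : Matrix κ (Fin n) ℝ := Lᵀ * G⁻¹ with hT
  set H := polyHess P s with hH
  clear_value T G
  have hLT : L * T = 1 := by
    rw [hT, ← Matrix.mul_assoc, ← hG, Matrix.mul_nonsing_inv _ hL]
  have hTt : Tᵀ = G⁻¹ * L := by
    rw [hT, Matrix.transpose_mul, Matrix.transpose_transpose, hGinv]
  refine ⟨WithLp.toLp 2 (Tᵀ *ᵥ (polyGrad P s).ofLp), Tᵀ * H * T, ?_, ?_, ?_⟩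
  · rw [Matrix.IsSymm, Matrix.transpose_mul, Matrix.transpose_mul, Matrix.transpose_transpose,
      (polyHess_isSymm P s : Hᵀ = H), Matrix.mul_assoc]
  · intro ε hε
    have hc : 0 < ε / (‖T‖ ^ 2 + 1) := by positivity
    have hTlim : Tendsto (fun h : EuclideanSpace ℝ (Fin n) => WithLp.toLp 2 (T *ᵥ h.ofLp)) (𝓝 0)
        (𝓝 (0 : EuclideanSpace ℝ κ)) := by
      have : Continuous fun h : EuclideanSpace ℝ (Fin n) => WithLp.toLp 2 (T *ᵥ h.ofLp) := by
        fun_prop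
      simpa using this.tendsto 0
    have hslim := hTlim.const_add s
    rw [add_zero] at hslim
    filter_upwards [hTlim.eventually (taylor_eval_le P s hc), hslim.eventually hmax] with h h1 h2
    have e1 : affineMap L ξ (s + WithLp.toLp 2 (T *ᵥ h.ofLp)) = affineMap L ξ s + h := by
      rw [affineMap_add, Matrix.mulVec_mulVec, hLT, Matrix.one_mulVec]
    have e2 : inner ℝ (WithLp.toLp 2 (Tᵀ *ᵥ (polyGrad P s).ofLp)) h =
        inner ℝ (polyGrad P s) (WithLp.toLp 2 (T *ᵥ h.ofLp)) := by
      rw [inner_eq_dotProduct, inner_eq_dotProduct, Matrix.mulVec_transpose,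
        ← Matrix.dotProduct_mulVec]
    have e3 : h.ofLp ⬝ᵥ ((Tᵀ * H * T) *ᵥ h.ofLp) =
        (T *ᵥ h.ofLp) ⬝ᵥ (H *ᵥ (T *ᵥ h.ofLp)) := by
      rw [← Matrix.mulVec_mulVec, ← Matrix.mulVec_mulVec, Matrix.dotProduct_mulVec,
        Matrix.vecMul_transpose]
    have e4 : ε / (‖T‖ ^ 2 + 1) * ‖WithLp.toLp 2 (T *ᵥ h.ofLp)‖ ^ 2 ≤ ε * ‖h‖ ^ 2 := by
      have h3 : ‖WithLp.toLp 2 (T *ᵥ h.ofLp)‖ ^ 2 ≤ ‖T‖ ^ 2 * ‖h‖ ^ 2 := by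
        rw [← mul_pow]
        exact pow_le_pow_left₀ (norm_nonneg _) (norm_toLp_mulVec_le T h.ofLp) 2
      rw [div_mul_eq_mul_div, div_le_iff₀ (by positivity)]
      nlinarith [mul_nonneg hε.le (sq_nonneg ‖h‖)]
    simp only [e1] at h2
    rw [e2, e3]
    linarith
  · set Z : Matrix κ κ ℝ := 1 - T * L with hZ
    have hTL : (T * L)ᵀ = T * L := by
      rw [Matrix.transpose_mul, hTt, hT, Matrix.mul_assoc]
    have hTLTL : T * L * (T * L) = T * L := by
      rw [Matrix.mul_assoc, ← Matrix.mul_assoc L T L, hLT, Matrix.one_mul]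
    have hLZ : L * Z = 0 := by
      rw [hZ, Matrix.mul_sub, Matrix.mul_one, ← Matrix.mul_assoc, hLT, Matrix.one_mul, sub_self]
    have hZZ : Z * Zᵀ = 1 - T * L := by
      rw [hZ, Matrix.transpose_sub, Matrix.transpose_one, hTL, Matrix.mul_sub, Matrix.sub_mul,
          Matrix.sub_mul, hTLTL]
      simp
    have hker : ∀ v : κ → ℝ, 0 ≤ v ⬝ᵥ ((Zᵀ * H * Z) *ᵥ v) := by
      intro v
      rw [← Matrix.mulVec_mulVec, ← Matrix.mulVec_mulVec, Matrix.dotProduct_mulVec,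
        Matrix.vecMul_transpose]
      have h1 := polyHess_nonpos_of_line_max (P := -P) (x := s) (v := WithLp.toLp 2 (Z *ᵥ v)) ?_
      · rw [polyHess_neg, Matrix.neg_mulVec, dotProduct_neg] at h1
        exact neg_nonpos.1 h1
      · have hlim := (tendsto_line (WithLp.toLp 2 (Z *ᵥ v) : EuclideanSpace ℝ κ)).const_add s
        rw [add_zero] at hlim
        filter_upwards [hlim.eventually hmax] with t ht
        have e : affineMap L ξ (s + t • WithLp.toLp 2 (Z *ᵥ v)) = affineMap L ξ s := by
          rw [affineMap_add, WithLp.ofLp_smul, Matrix.mulVec_smul, Matrix.mulVec_mulVec, hLZ,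
            Matrix.zero_mulVec, smul_zero, WithLp.toLp_zero, add_zero]
        simp only [e] at ht
        rw [map_neg, map_neg]
        linarith
    have h2 := trace_mul_nonneg_of_posSemidef (Matrix.PosSemidef.one (n := κ) (R := ℝ)) hker
    rw [Matrix.one_mul, Matrix.mul_assoc, Matrix.trace_mul_comm, Matrix.mul_assoc, hZZ,
      Matrix.mul_sub, Matrix.mul_one, Matrix.trace_sub, trace_polyHess] at h2
    have h3 : (G * (Tᵀ * H * T)).trace = (H * (T * L)).trace := by
      rw [hTt, ← Matrix.mul_assoc, ← Matrix.mul_assoc, ← Matrix.mul_assoc,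
        Matrix.mul_nonsing_inv _ hL, Matrix.one_mul, Matrix.mul_assoc, Matrix.trace_mul_comm, Matrix.mul_assoc]
    rw [h3]
    linarith

/-- The polynomial `M + c |w + D s| ^ 2` in `s`. -/
noncomputable def affineSqPoly (M c : ℝ) (w : EuclideanSpace ℝ (Fin n))
    (D : Matrix (Fin n) κ ℝ) : MvPolynomial κ ℝ :=
  C M + c • ∑ i, (C (w i) + ∑ j, C (D i j) * X j) ^ 2

theorem eval_affineSqPoly (M c : ℝ) (w : EuclideanSpace ℝ (Fin n)) (D : Matrix (Fin n) κ ℝ)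
    (s : EuclideanSpace ℝ κ) :
    eval s.ofLp (affineSqPoly M c w D) = M + c * ‖affineMap D w s‖ ^ 2 := by
  simp [affineSqPoly, EuclideanSpace.real_norm_sq_eq, affineMap, Matrix.mulVec, dotProduct]

theorem frobenius_norm_sq {ι : Type*} [Fintype ι] (D : Matrix ι κ ℝ) :
    ‖D‖ ^ 2 = ∑ i, ∑ j, D i j ^ 2 := by
  rw [Matrix.frobenius_norm_def, ← Real.sqrt_eq_rpow, Real.sq_sqrt]
  · simp
  · positivity

theorem polyLaplacian_affineSqPoly (M c : ℝ) (w : EuclideanSpace ℝ (Fin n))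
    (D : Matrix (Fin n) κ ℝ) :
    polyLaplacian (affineSqPoly M c w D) = C (2 * c * ‖D‖ ^ 2) := by
  classical
  have h1 : ∀ i k, pderiv k (C (w i) + ∑ j, C (D i j) * X j : MvPolynomial κ ℝ) = C (D i k) := by
    intro i k
    rw [map_add, pderiv_C, zero_add, map_sum, Finset.sum_eq_single k]
    · rw [pderiv_C_mul, pderiv_X_self, mul_one]
    · intro j _ hj
      rw [pderiv_C_mul, pderiv_X_of_ne hj, mul_zero]
    · simp
  have h2 : ∀ i k, pderiv k (pderiv k ((C (w i) + ∑ j, C (D i j) * X j : MvPolynomial κ ℝ) ^ 2)) =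
      C (2 * D i k ^ 2) := by
    intro i k
    rw [sq, pderiv_mul, h1, map_add, pderiv_mul, pderiv_mul, h1, pderiv_C, zero_mul, zero_add,
      mul_zero, add_zero, ← C_mul, ← C_add]
    congr 1
    ring
  rw [affineSqPoly, polyLaplacian_add, polyLaplacian_C, zero_add, polyLaplacian_smul,
    polyLaplacian]
  simp only [map_sum, h2]
  have h3 : ∑ k, ∑ i, (C (2 * D i k ^ 2) : MvPolynomial κ ℝ) = C (∑ k, ∑ i, 2 * D i k ^ 2) := by
    simp only [map_sum]
  rw [h3, smul_eq_C_mul, ← C_mul, frobenius_norm_sq, Finset.sum_comm]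
  simp only [← Finset.mul_sum]
  congr 1
  ring

end Pullback

/-! ### The theorem on sums in trace form -/

section SumOfSubsolutions
variable {n r : ℕ}

/-- The matrix `(σ | √δ I)`, a square root of `σ σᵀ + δ I`. -/
noncomputable def regularizedRoot (σ : Matrix (Fin n) (Fin r) ℝ) (δ : ℝ) :
    Matrix (Fin n) (Fin r ⊕ Fin n) ℝ :=
  Matrix.fromCols σ (√δ • (1 : Matrix (Fin n) (Fin n) ℝ))

theorem regularizedRoot_mul_transpose (σ : Matrix (Fin n) (Fin r) ℝ) {δ : ℝ} (hδ : 0 ≤ δ) :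
    regularizedRoot σ δ * (regularizedRoot σ δ)ᵀ =
      σ * σᵀ + δ • (1 : Matrix (Fin n) (Fin n) ℝ) := by
  rw [regularizedRoot, Matrix.transpose_fromCols, Matrix.fromCols_mul_fromRows]
  simp [smul_smul, Real.mul_self_sqrt hδ]

theorem isUnit_det_regularizedRoot (σ : Matrix (Fin n) (Fin r) ℝ) {δ : ℝ} (hδ : 0 < δ) :
    IsUnit (regularizedRoot σ δ * (regularizedRoot σ δ)ᵀ).det := by
  rw [regularizedRoot_mul_transpose σ hδ.le, ← Matrix.isUnit_iff_isUnit_det, add_comm]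
  exact ((Matrix.PosDef.one.smul hδ).add_posSemidef (posSemidef_mul_transpose σ)).isUnit

theorem norm_regularizedRoot_sub_sq (σ τ : Matrix (Fin n) (Fin r) ℝ) (δ : ℝ) :
    ‖regularizedRoot σ δ - regularizedRoot τ δ‖ ^ 2 = ‖σ - τ‖ ^ 2 := by
  rw [frobenius_norm_sq, frobenius_norm_sq]
  refine Finset.sum_congr rfl fun i _ => ?_
  simp [regularizedRoot, Fintype.sum_sum_type]

theorem norm_add_sub_sq_le {E : Type*} [SeminormedAddCommGroup E] (a c d : E) :
    ‖a + c - d‖ ^ 2 ≤ 2 * ‖a‖ ^ 2 + 4 * ‖c‖ ^ 2 + 4 * ‖d‖ ^ 2 := by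
  have h : ‖a + c - d‖ ≤ ‖a‖ + ‖c‖ + ‖d‖ :=
    (norm_sub_le _ _).trans (by linarith [norm_add_le a c])
  have h2 := pow_le_pow_left₀ (norm_nonneg _) h 2
  nlinarith [sq_nonneg (‖a‖ - ‖c‖ - ‖d‖), sq_nonneg (‖c‖ - ‖d‖)]

/-- If `f` is touched from above at `x₀` by the paraboloid `θ |· - y₀| ^ 2`, then the maximizers in
its sup-convolution depend on the base point in a Lipschitz way at `(3 x₀ + y₀) / 4`. -/
theorem IsSupConvSelection.norm_sub_le {K : Set (EuclideanSpace ℝ (Fin n))}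
    {f : EuclideanSpace ℝ (Fin n) → ℝ} {θ : ℝ}
    {S : EuclideanSpace ℝ (Fin n) → EuclideanSpace ℝ (Fin n)}
    (hS : IsSupConvSelection K f (4 * θ) S) (hθ : 0 < θ) {x₀ y₀ : EuclideanSpace ℝ (Fin n)}
    (hx₀ : x₀ ∈ K)
    (hf : ∀ x ∈ K, f x ≤ f x₀ + θ * (‖x - y₀‖ ^ 2 - ‖x₀ - y₀‖ ^ 2)) (ξ : EuclideanSpace ℝ (Fin n)) :
    ‖S ξ - x₀‖ ≤ 8 / 3 * ‖ξ - (x₀ - (1 / 4 : ℝ) • (x₀ - y₀))‖ := by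
  have h1 := hf _ (hS ξ).1
  have h2 := hS.le_supConv hx₀ ξ
  rw [supConv] at h2
  set e := S ξ - x₀ with he
  set Δ := x₀ - y₀ with hΔ
  set g := ξ - (x₀ - (1 / 4 : ℝ) • Δ) with hg
  have e1 : S ξ - y₀ = e + Δ := by rw [he, hΔ]; abel
  have e2 : x₀ - ξ = (1 / 4 : ℝ) • Δ - g := by rw [hg]; abel
  have e3 : S ξ - ξ = e + ((1 / 4 : ℝ) • Δ - g) := by rw [he, hg]; abel
  rw [e1, norm_add_sq_real] at h1
  rw [e3, e2, norm_add_sq_real, inner_sub_right, inner_smul_right] at h2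
  have h3 : 3 * ‖e‖ ^ 2 ≤ 8 * (‖e‖ * ‖g‖) := by
    have h4 : θ * (3 * ‖e‖ ^ 2) ≤ θ * (8 * inner ℝ e g) := by nlinarith
    have h5 := le_of_mul_le_mul_left h4 hθ
    linarith [real_inner_le_norm e g]
  rcases eq_or_lt_of_le (norm_nonneg e) with h0 | h0
  · rw [← h0]; positivity
  · nlinarith

/-- **Theorem on sums, in trace form.** If `f₁ x + f₂ y - θ |x - y| ^ 2` attains its maximum at an
interior point `(x₀, y₀)`, then the lower bounds in the two linear equations add up to at most the
action of the coupled operator on the penalization. -/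
theorem LinearSubsolution.add_le [NeZero n] {K : Set (EuclideanSpace ℝ (Fin n))} (hK : IsCompact K)
    {f₁ f₂ : EuclideanSpace ℝ (Fin n) → ℝ}
    {b : EuclideanSpace ℝ (Fin n) → EuclideanSpace ℝ (Fin n)}
    {σ : EuclideanSpace ℝ (Fin n) → Matrix (Fin n) (Fin r) ℝ} {κ₁ κ₂ θ M : ℝ} (hθ : 0 < θ)
    (hu₁ : UpperSemicontinuousOn f₁ K) (hu₂ : UpperSemicontinuousOn f₂ K)
    (h₁ : LinearSubsolution (interior K) b σ κ₁ f₁) (h₂ : LinearSubsolution (interior K) b σ κ₂ f₂)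
    (hle : ∀ x ∈ K, ∀ y ∈ K, f₁ x + f₂ y ≤ M + θ * ‖x - y‖ ^ 2)
    {x₀ y₀ : EuclideanSpace ℝ (Fin n)} (hx₀ : x₀ ∈ interior K) (hy₀ : y₀ ∈ interior K)
    (heq : f₁ x₀ + f₂ y₀ = M + θ * ‖x₀ - y₀‖ ^ 2)
    (hbx : ContinuousAt b x₀) (hby : ContinuousAt b y₀)
    (hσx : ContinuousAt σ x₀) (hσy : ContinuousAt σ y₀) :
    κ₁ + κ₂ ≤ inner ℝ (b x₀ - b y₀) ((2 * θ) • (x₀ - y₀)) + 4 * θ * ‖σ x₀ - σ y₀‖ ^ 2 := by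
  have hx₀K := interior_subset hx₀
  have hy₀K := interior_subset hy₀
  obtain ⟨S₁, hS₁⟩ := exists_isSupConvSelection hK ⟨x₀, hx₀K⟩ hu₁ (4 * θ)
  obtain ⟨S₂, hS₂⟩ := exists_isSupConvSelection hK ⟨x₀, hx₀K⟩ hu₂ (4 * θ)
  -- The base points for which the quadratic inequality behind `hsum` is an equality at `(x₀, y₀)`.
  set ξ₁ := x₀ - (1 / 4 : ℝ) • (x₀ - y₀) with hξ₁
  set ξ₂ := y₀ - (1 / 4 : ℝ) • (y₀ - x₀) with hξ₂
  have hlip₁ := hS₁.norm_sub_le hθ hx₀K (y₀ := y₀) fun x hx => by linarith [hle x hx y₀ hy₀K]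
  have hlip₂ := hS₂.norm_sub_le hθ hy₀K (y₀ := x₀) fun y hy => by
    have := hle x₀ hx₀K y hy
    rw [norm_sub_rev y x₀, norm_sub_rev y₀ x₀]
    linarith
  have hsum : ∀ ξ ζ, supConv f₁ (4 * θ) S₁ ξ + supConv f₂ (4 * θ) S₂ ζ ≤
      M + 2 * θ * ‖ξ - ζ‖ ^ 2 := by
    intro ξ ζ
    have h3 := hle _ (hS₁ ξ).1 _ (hS₂ ζ).1
    have h4 := norm_add_sub_sq_le (ξ - ζ) (S₁ ξ - ξ) (S₂ ζ - ζ)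
    rw [show ξ - ζ + (S₁ ξ - ξ) - (S₂ ζ - ζ) = S₁ ξ - S₂ ζ by abel] at h4
    have h5 := mul_le_mul_of_nonneg_left h4 hθ.le
    rw [supConv, supConv]
    linarith
  have hξξ : ξ₁ - ξ₂ = (1 / 2 : ℝ) • (x₀ - y₀) := by rw [hξ₁, hξ₂]; module
  have hsum₀ : supConv f₁ (4 * θ) S₁ ξ₁ + supConv f₂ (4 * θ) S₂ ξ₂ =
      M + 2 * θ * ‖ξ₁ - ξ₂‖ ^ 2 := by
    refine le_antisymm (hsum _ _) ?_
    have h3 := hS₁.le_supConv hx₀K ξ₁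
    have h4 := hS₂.le_supConv hy₀K ξ₂
    rw [show x₀ - ξ₁ = (1 / 4 : ℝ) • (x₀ - y₀) by rw [hξ₁]; abel, norm_smul] at h3
    rw [show y₀ - ξ₂ = (1 / 4 : ℝ) • (y₀ - x₀) by rw [hξ₂]; abel, norm_smul,
      norm_sub_rev y₀ x₀] at h4
    rw [hξξ, norm_smul]
    norm_num at h3 h4 ⊢
    nlinarith
  have main : ∀ δ > 0, κ₁ + κ₂ ≤ inner ℝ (b x₀ - b y₀) ((2 * θ) • (x₀ - y₀))
      + 4 * θ * ‖σ x₀ - σ y₀‖ ^ 2 + (16 * θ * n + 2) * δ := by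
    intro δ hδ
    have hf₁ := h₁.eventually_frozen hS₁ hx₀ hlip₁ hbx hσx hδ
    have hf₂ := h₂.eventually_frozen hS₂ hy₀ hlip₂ hby hσy hδ
    set L₁ := regularizedRoot (σ x₀) δ with hL₁
    set L₂ := regularizedRoot (σ y₀) δ with hL₂
    rw [← regularizedRoot_mul_transpose _ hδ.le, ← hL₁] at hf₁
    rw [← regularizedRoot_mul_transpose _ hδ.le, ← hL₂] at hf₂
    have ht₁ : Tendsto (affineMap L₁ ξ₁) (𝓝 0) (𝓝 ξ₁) := by
      simpa [affineMap_zero] using (continuous_affineMap L₁ ξ₁).tendsto 0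
    have ht₂ : Tendsto (affineMap L₂ ξ₂) (𝓝 0) (𝓝 ξ₂) := by
      simpa [affineMap_zero] using (continuous_affineMap L₂ ξ₂).tendsto 0
    obtain ⟨ρ, hρ, hball⟩ := Metric.eventually_nhds_iff_ball.1
      ((ht₁.eventually hf₁).and (ht₂.eventually hf₂))
    have hv₁ : ViscLaplacianGe ρ (κ₁ - inner ℝ (b x₀) ((2 * (4 * θ)) • (x₀ - ξ₁))
        - 2 * (4 * θ) * n * δ - δ) fun s => supConv f₁ (4 * θ) S₁ (affineMap L₁ ξ₁ s) := by
      intro s hs P hP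
      obtain ⟨p, X, hX, hjet, htr⟩ :=
        exists_upperJet_of_pullback (isUnit_det_regularizedRoot (σ x₀) hδ) hP
      exact ((hball s hs).1 p X hX hjet).trans htr
    have hv₂ : ViscLaplacianGe ρ (κ₂ - inner ℝ (b y₀) ((2 * (4 * θ)) • (y₀ - ξ₂))
        - 2 * (4 * θ) * n * δ - δ) fun s => supConv f₂ (4 * θ) S₂ (affineMap L₂ ξ₂ s) := by
      intro s hs P hP
      obtain ⟨p, X, hX, hjet, htr⟩ :=
        exists_upperJet_of_pullback (isUnit_det_regularizedRoot (σ y₀) hδ) hP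
      exact ((hball s hs).2 p X hX hjet).trans htr
    have key := hv₁.add_le hρ hv₂
      ((hS₁.continuous_supConv (by positivity) hK.isBounded).comp (continuous_affineMap _ _))
      ((hS₂.continuous_supConv (by positivity) hK.isBounded).comp (continuous_affineMap _ _))
      (polyLaplacian_affineSqPoly M (2 * θ) (ξ₁ - ξ₂) (L₁ - L₂)) ?_ ?_
    · rw [norm_regularizedRoot_sub_sq] at key
      have e1 : (2 * (4 * θ)) • (x₀ - ξ₁) = (2 * θ) • (x₀ - y₀) := by rw [hξ₁]; module
      have e2 : (2 * (4 * θ)) • (y₀ - ξ₂) = -((2 * θ) • (x₀ - y₀)) := by rw [hξ₂]; module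
      rw [e1, e2, inner_neg_right] at key
      rw [inner_sub_left]
      linarith
    · intro s
      rw [eval_affineSqPoly]
      refine (hsum _ _).trans (le_of_eq ?_)
      congr 4
      simp only [affineMap, Matrix.sub_mulVec, WithLp.toLp_sub]
      abel
    · rw [eval_affineSqPoly, affineMap_zero, affineMap_zero, affineMap_zero]
      exact hsum₀
  refine le_of_forall_pos_le_add fun ε hε => ?_
  have hc : 0 < 16 * θ * n + 2 := by positivity
  refine (main (ε / (16 * θ * n + 2)) (by positivity)).trans (le_of_eq ?_)
  rw [mul_div_cancel₀ _ hc.ne']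

end SumOfSubsolutions

/-! ### Local comparison by doubling of variables -/

section LocalComparison
variable {n r : ℕ}

theorem upperSemicontinuousOn_add_prod {E : Type*} [TopologicalSpace E] {K : Set E}
    {f g : E → ℝ} (hf : UpperSemicontinuousOn f K) (hg : UpperSemicontinuousOn g K) :
    UpperSemicontinuousOn (fun z : E × E => f z.1 + g z.2) (K ×ˢ K) := by
  refine UpperSemicontinuousOn.add ?_ ?_
  · intro z hz y hy
    have ht : Tendsto Prod.fst (𝓝[K ×ˢ K] z) (𝓝[K] z.1) :=
      continuousWithinAt_fst.tendsto_nhdsWithin fun w hw => hw.1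
    exact ht.eventually (hf z.1 hz.1 y hy)
  · intro z hz y hy
    have ht : Tendsto Prod.snd (𝓝[K ×ˢ K] z) (𝓝[K] z.2) :=
      continuousWithinAt_snd.tendsto_nhdsWithin fun w hw => hw.2
    exact ht.eventually (hg z.2 hz.2 y hy)

theorem continuousAt_of_lipschitz_on {E F : Type*} [SeminormedAddCommGroup E]
    [SeminormedAddCommGroup F] {K : Set E} {g : E → F} {B : ℝ}
    (hg : ∀ x ∈ K, ∀ y ∈ K, ‖g x - g y‖ ≤ B * ‖x - y‖) {x : E} (hx : x ∈ interior K) :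
    ContinuousAt g x := by
  refine tendsto_iff_norm_sub_tendsto_zero.2
    (squeeze_zero' (Eventually.of_forall fun _ => norm_nonneg _) (g := fun y => B * ‖y - x‖) ?_ ?_)
  · filter_upwards [mem_interior_iff_mem_nhds.1 hx] with y hy
    exact hg y hy x (interior_subset hx)
  · have : Continuous fun y : E => B * ‖y - x‖ := by fun_prop
    simpa using this.tendsto x

/-- Local comparison by doubling of variables: if `f₁` and `f₂` are subsolutions of the same linear
equation up to constants with positive sum, and `f₂` is Lipschitz, then `f₁ + f₂` has no strict
quadratic interior maximum. -/
theorem LinearSubsolution.not_strict_max [NeZero n] {x₀ : EuclideanSpace ℝ (Fin n)} {ρ : ℝ}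
    (hρ : 0 < ρ) {f₁ f₂ : EuclideanSpace ℝ (Fin n) → ℝ}
    {b : EuclideanSpace ℝ (Fin n) → EuclideanSpace ℝ (Fin n)}
    {σ : EuclideanSpace ℝ (Fin n) → Matrix (Fin n) (Fin r) ℝ} {κ₁ κ₂ μ Λ B₁ B₂ : ℝ}
    (hu₁ : UpperSemicontinuousOn f₁ (Metric.closedBall x₀ ρ))
    (hΛ : 0 ≤ Λ) (hf₂ : ∀ x ∈ Metric.closedBall x₀ ρ, ∀ y ∈ Metric.closedBall x₀ ρ,
      ‖f₂ x - f₂ y‖ ≤ Λ * ‖x - y‖)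
    (h₁ : LinearSubsolution (Metric.ball x₀ ρ) b σ κ₁ f₁)
    (h₂ : LinearSubsolution (Metric.ball x₀ ρ) b σ κ₂ f₂) (hκ : 0 < κ₁ + κ₂)
    (hb : ∀ x ∈ Metric.closedBall x₀ ρ, ∀ y ∈ Metric.closedBall x₀ ρ,
      ‖b x - b y‖ ≤ B₁ * ‖x - y‖)
    (hσ : ∀ x ∈ Metric.closedBall x₀ ρ, ∀ y ∈ Metric.closedBall x₀ ρ,
      ‖σ x - σ y‖ ≤ B₂ * ‖x - y‖) (hμ : 0 < μ)
    (hmax : ∀ x ∈ Metric.closedBall x₀ ρ, f₁ x + f₂ x ≤ f₁ x₀ + f₂ x₀ - μ * ‖x - x₀‖ ^ 2) :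
    False := by
  set K := Metric.closedBall x₀ ρ with hKdef
  have hK : IsCompact K := isCompact_closedBall x₀ ρ
  have hx₀ : x₀ ∈ K := Metric.mem_closedBall_self hρ.le
  have hint : interior K = Metric.ball x₀ ρ := interior_closedBall x₀ hρ.ne'
  rw [← hint] at h₁ h₂
  have hu₂ : UpperSemicontinuousOn f₂ K := by
    refine ContinuousOn.upperSemicontinuousOn fun x hx => ?_
    refine tendsto_iff_norm_sub_tendsto_zero.2
      (squeeze_zero' (Eventually.of_forall fun _ => norm_nonneg _) (g := fun y => Λ * ‖y - x‖) ?_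
      ?_)
    · filter_upwards [self_mem_nhdsWithin] with y hy
      exact hf₂ y hy x hx
    · have : Continuous fun y : EuclideanSpace ℝ (Fin n) => Λ * ‖y - x‖ := by fun_prop
      simpa using (this.tendsto x).mono_left nhdsWithin_le_nhds
  have hlim : ∀ c : ℝ, Tendsto (fun θ : ℝ => c / θ) atTop (𝓝 0) := fun c =>
    tendsto_const_nhds.div_atTop tendsto_id
  -- The penalization is taken so large that the doubled maximum point is near the diagonal, near
  -- `x₀`, and the error terms are smaller than `κ₁ + κ₂`.
  obtain ⟨θ, hθ, hθ1, hθ2, hθ3⟩ := ((eventually_gt_atTop 0).and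
    (((hlim Λ).eventually (gt_mem_nhds (half_pos hρ))).and
    (((hlim (Λ ^ 2 / μ)).eventually (gt_mem_nhds (show 0 < (ρ / 2) ^ 2 by positivity))).and
    ((hlim ((2 * |B₁| + 4 * B₂ ^ 2) * Λ ^ 2)).eventually (gt_mem_nhds hκ))))).exists
  obtain ⟨⟨x, y⟩, ⟨hx, hy⟩, hxy⟩ := UpperSemicontinuousOn.exists_isMaxOn
    (f := fun z : EuclideanSpace ℝ (Fin n) × EuclideanSpace ℝ (Fin n) =>
      (f₁ z.1 + f₂ z.2) + -(θ * ‖z.1 - z.2‖ ^ 2))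
    (show (K ×ˢ K).Nonempty from ⟨(x₀, x₀), hx₀, hx₀⟩) (hK.prod hK)
    ((upperSemicontinuousOn_add_prod hu₁ hu₂).add
      (ContinuousOn.upperSemicontinuousOn (by fun_prop)))
  simp only at hx hy
  have hM : ∀ x' ∈ K, ∀ y' ∈ K, f₁ x' + f₂ y' - θ * ‖x' - y'‖ ^ 2 ≤
      f₁ x + f₂ y - θ * ‖x - y‖ ^ 2 := by
    intro x' hx' y' hy'
    have := hxy (show (x', y') ∈ K ×ˢ K from ⟨hx', hy'⟩)
    simp only [mem_ofPred_eq] at this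
    linarith
  have hL := (abs_le.1 (hf₂ x hx y hy))
  set d := ‖x - y‖ with hd
  have hd0 : 0 ≤ d := norm_nonneg _
  have hdiag := hM x hx x hx
  rw [sub_self, norm_zero] at hdiag
  have h3 : θ * d ^ 2 ≤ Λ * d := by linarith [hL.1]
  have h4 : θ * d ≤ Λ := by
    rcases eq_or_lt_of_le hd0 with h0 | h0
    · rw [← h0, mul_zero]
      exact hΛ
    · refine le_of_mul_le_mul_right ?_ h0
      linarith
  have hdΛ : d ≤ Λ / θ := by rw [le_div_iff₀ hθ]; linarith
  have h5 : θ * d ^ 2 ≤ Λ ^ 2 / θ := by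
    rw [le_div_iff₀ hθ]
    nlinarith [mul_nonneg hθ.le hd0]
  have h6 : ‖x - x₀‖ ^ 2 < (ρ / 2) ^ 2 := by
    refine lt_of_le_of_lt ?_ hθ2
    have h7 := hM x₀ hx₀ x₀ hx₀
    rw [sub_self, norm_zero] at h7
    have h8 := hmax x hx
    rw [le_div_iff₀ hθ, le_div_iff₀ hμ]
    have h9 : μ * ‖x - x₀‖ ^ 2 ≤ Λ * d := by
      nlinarith [hL.1, mul_nonneg hθ.le (sq_nonneg d)]
    nlinarith [mul_le_mul_of_nonneg_left h4 hΛ]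
  have h7 : ‖x - x₀‖ < ρ / 2 := lt_of_pow_lt_pow_left₀ 2 (by positivity) h6
  have hxi : x ∈ interior K := by
    rw [hint, mem_ball_iff_norm]
    linarith
  have hyi : y ∈ interior K := by
    rw [hint, mem_ball_iff_norm]
    have : ‖y - x₀‖ ≤ ‖x - y‖ + ‖x - x₀‖ := by
      rw [norm_sub_rev x y]
      simpa using norm_add_le (y - x) (x - x₀)
    linarith
  have key := h₁.add_le hK hθ hu₁ hu₂ h₂ (M := f₁ x + f₂ y - θ * d ^ 2)
    (fun x' hx' y' hy' => by linarith [hM x' hx' y' hy']) hxi hyi (by ring)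
    (continuousAt_of_lipschitz_on hb hxi) (continuousAt_of_lipschitz_on hb hyi)
    (continuousAt_of_lipschitz_on hσ hxi) (continuousAt_of_lipschitz_on hσ hyi)
  have h8 : inner ℝ (b x - b y) ((2 * θ) • (x - y)) ≤ 2 * |B₁| * (θ * d ^ 2) := by
    refine (real_inner_le_norm _ _).trans ?_
    rw [norm_smul, Real.norm_eq_abs, abs_of_pos (by positivity), ← hd]
    have h9 : ‖b x - b y‖ ≤ |B₁| * d :=
      (hb x hx y hy).trans (mul_le_mul_of_nonneg_right (le_abs_self _) hd0)
    calc ‖b x - b y‖ * (2 * θ * d) ≤ |B₁| * d * (2 * θ * d) :=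
          mul_le_mul_of_nonneg_right h9 (by positivity)
      _ = 2 * |B₁| * (θ * d ^ 2) := by ring
  have h9 : 4 * θ * ‖σ x - σ y‖ ^ 2 ≤ 4 * B₂ ^ 2 * (θ * d ^ 2) := by
    have h10 := pow_le_pow_left₀ (norm_nonneg _) (hσ x hx y hy) 2
    rw [← hd] at h10
    nlinarith
  have h10 : (2 * |B₁| + 4 * B₂ ^ 2) * (θ * d ^ 2) ≤ (2 * |B₁| + 4 * B₂ ^ 2) * Λ ^ 2 / θ := by
    rw [mul_div_assoc]
    exact mul_le_mul_of_nonneg_left h5 (by positivity)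
  linarith

end LocalComparison

/-! ### The distance from the boundary and its logarithm -/

section Distance
variable {n : ℕ} {Ω : Set (EuclideanSpace ℝ (Fin n))}

theorem bdrySignedDist_of_mem {x : EuclideanSpace ℝ (Fin n)} (hx : x ∈ Ω) :
    bdrySignedDist Ω x = Metric.infDist x Ωᶜ := by
  rw [bdrySignedDist, Metric.infDist_zero_of_mem_closure (subset_closure.trans subset_closure hx),
    sub_zero]

theorem infDist_compl_pos (hΩ : IsOpen Ω) (hne : Ωᶜ.Nonempty) {x : EuclideanSpace ℝ (Fin n)}
    (hx : x ∈ Ω) : 0 < Metric.infDist x Ωᶜ :=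
  (hΩ.isClosed_compl.notMem_iff_infDist_pos hne).1 fun h => h hx

/-- Every point of `Ω` has a nearest boundary point. -/
theorem exists_nearest_frontier (hΩ : IsOpen Ω) (hne : Ωᶜ.Nonempty)
    {x : EuclideanSpace ℝ (Fin n)} (hx : x ∈ Ω) :
    ∃ z ∈ frontier Ω, bdrySignedDist Ω x = ‖x - z‖ ∧ 0 < ‖x - z‖ := by
  obtain ⟨z, hz, hd⟩ := hΩ.isClosed_compl.exists_infDist_eq_dist hne x
  have hpos := infDist_compl_pos hΩ hne hx
  rw [hd] at hpos
  refine ⟨z, ⟨?_, by rwa [hΩ.interior_eq]⟩, ?_, by rwa [← dist_eq_norm]⟩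
  · have hball : Metric.ball x (dist x z) ⊆ Ω := by
      intro y hy
      by_contra hyΩ
      have := Metric.infDist_le_dist_of_mem (x := x) (show y ∈ Ωᶜ from hyΩ)
      rw [hd, dist_comm x y] at this
      exact absurd (Metric.mem_ball.1 hy) (not_lt.2 this)
    refine closure_mono hball ?_
    rw [closure_ball x hpos.ne', Metric.mem_closedBall, dist_comm]
  · rw [bdrySignedDist_of_mem hx, hd, dist_eq_norm]

theorem bdrySignedDist_le {x z : EuclideanSpace ℝ (Fin n)} (hx : x ∈ Ω) (hz : z ∉ Ω) :
    bdrySignedDist Ω x ≤ ‖x - z‖ := by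
  rw [bdrySignedDist_of_mem hx, ← dist_eq_norm]
  exact Metric.infDist_le_dist_of_mem hz

theorem bdrySignedDist_sub_le {x y : EuclideanSpace ℝ (Fin n)} (hx : x ∈ Ω) (hy : y ∈ Ω) :
    bdrySignedDist Ω x - bdrySignedDist Ω y ≤ ‖x - y‖ := by
  rw [bdrySignedDist_of_mem hx, bdrySignedDist_of_mem hy, ← dist_eq_norm]
  linarith [Metric.infDist_le_infDist_add_dist (s := Ωᶜ) (x := x) (y := y)]

theorem mem_interiorNormals {x z : EuclideanSpace ℝ (Fin n)} (hx : x ∈ Ω)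
    (hd : bdrySignedDist Ω x = ‖x - z‖) (hpos : 0 < ‖x - z‖) :
    (‖x - z‖)⁻¹ • (x - z) ∈ interiorNormals Ω z := by
  refine ⟨?_, x, hx, ?_⟩
  · rw [norm_smul, norm_inv, norm_norm, inv_mul_cancel₀ hpos.ne']
  · rw [hd, smul_smul, mul_inv_cancel₀ hpos.ne', one_smul, add_sub_cancel]

theorem nonpos_of_mul_le_sq {a C : ℝ} (h : ∀ᶠ t : ℝ in 𝓝[>] 0, t * a ≤ C * t ^ 2) : a ≤ 0 := by
  have hlim : Tendsto (fun t : ℝ => C * t) (𝓝[>] 0) (𝓝 0) := by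
    have : Continuous fun t : ℝ => C * t := by fun_prop
    simpa using (this.tendsto 0).mono_left nhdsWithin_le_nhds
  refine ge_of_tendsto hlim ?_
  filter_upwards [h, self_mem_nhdsWithin] with t ht ht0
  have ht0' : 0 < t := ht0
  refine le_of_mul_le_mul_left ?_ ht0'
  linarith

/-- The degeneracy of the diffusion in the normal directions at the boundary, together with the
Lipschitz continuity of `σ`, bounds `σᵀ p` by the distance to the boundary for every supergradient
`p` of the distance function. At points with several nearest boundary points `p` is only an average
of normals, so the bound is derived from the directional derivative of the distance in the single
direction `-σ σᵀ p`. -/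
theorem norm_transpose_mulVec_le {r : ℕ} (hΩ : IsOpen Ω) (hne : Ωᶜ.Nonempty)
    {U : Set (EuclideanSpace ℝ (Fin n))}
    {σ : EuclideanSpace ℝ (Fin n) → Matrix (Fin n) (Fin r) ℝ} {B : ℝ} (hB : 0 ≤ B)
    (hσ : ∀ x ∈ closure Ω, ∀ y ∈ closure Ω, ‖σ x - σ y‖ ≤ B * ‖x - y‖)
    (hdeg : ∀ z ∈ frontier Ω ∩ U, ∀ ν ∈ interiorNormals Ω z, (σ z)ᵀ *ᵥ ν.ofLp = 0)
    {y p : EuclideanSpace ℝ (Fin n)} {Z : Matrix (Fin n) (Fin n) ℝ} (hy : y ∈ Ω)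
    (hU : Metric.ball y (2 * bdrySignedDist Ω y) ⊆ U)
    (hjet : UpperJet (bdrySignedDist Ω) y p Z) :
    ‖WithLp.toLp 2 ((σ y)ᵀ *ᵥ p.ofLp)‖ ≤ B * bdrySignedDist Ω y := by
  set d := bdrySignedDist Ω with hddef
  have hdy : 0 < d y := by rw [hddef, bdrySignedDist_of_mem hy]; exact infDist_compl_pos hΩ hne hy
  set w : Fin r → ℝ := (σ y)ᵀ *ᵥ p.ofLp with hw
  set e : EuclideanSpace ℝ (Fin n) := -WithLp.toLp 2 (σ y *ᵥ w) with he
  set W := ‖(WithLp.toLp 2 w : EuclideanSpace ℝ (Fin r))‖ with hW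
  have hW0 : 0 ≤ W := norm_nonneg _
  have hpe : inner ℝ p e = -W ^ 2 := by
    rw [he, inner_neg_right, inner_eq_dotProduct, Matrix.dotProduct_mulVec,
      ← Matrix.mulVec_transpose, ← hw, dotProduct_self_eq_norm_sq]
  have key : W ^ 2 - B * d y * W ≤ 0 := by
    refine nonpos_of_mul_le_sq (C := 2 * B * ‖e‖ * W + ‖e‖ ^ 2 / d y
      + (1 / 2 : ℝ) * (e.ofLp ⬝ᵥ (Z *ᵥ e.ofLp)) + ‖e‖ ^ 2) ?_
    have hline : Tendsto (fun t : ℝ => y + t • e) (𝓝 0) (𝓝 y) := by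
      have := (tendsto_line e).const_add y
      rwa [add_zero] at this
    have hsmall : ∀ᶠ t : ℝ in 𝓝 0, t * ‖e‖ < d y / 2 := by
      have : Continuous fun t : ℝ => t * ‖e‖ := by fun_prop
      exact (this.tendsto 0).eventually (gt_mem_nhds (by simpa using half_pos hdy))
    filter_upwards [((tendsto_line e).eventually (hjet 1 one_pos)).filter_mono nhdsWithin_le_nhds,
      (hline.eventually (hΩ.mem_nhds hy)).filter_mono nhdsWithin_le_nhds,
      hsmall.filter_mono nhdsWithin_le_nhds, self_mem_nhdsWithin] with t h1 hxt h3 ht0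
    have ht : 0 < t := ht0
    obtain ⟨z, hz, hdz, hpos⟩ := exists_nearest_frontier hΩ hne hxt
    rw [← hddef] at hdz
    have hte : ‖t • e‖ = t * ‖e‖ := by rw [norm_smul, Real.norm_eq_abs, abs_of_pos ht]
    have hzΩ : z ∉ Ω := by
      have := hz.2
      rwa [hΩ.interior_eq] at this
    set v := y + t • e - z with hv
    have hyz : y - z = v - t • e := by rw [hv]; abel
    have hd1 : d (y + t • e) - d y ≤ t * ‖e‖ := by
      have := bdrySignedDist_sub_le hxt hy
      rwa [add_sub_cancel_left, hte] at this
    have hd2 : d y - d (y + t • e) ≤ t * ‖e‖ := by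
      have := bdrySignedDist_sub_le hy hxt
      rwa [sub_add_cancel_left, norm_neg, hte] at this
    have hyz_le : ‖y - z‖ ≤ d y + 2 * (t * ‖e‖) := by
      rw [hyz]
      refine (norm_sub_le _ _).trans ?_
      rw [hte, ← hdz]
      linarith
    have hzU : z ∈ U := by
      refine hU ?_
      rw [mem_ball_iff_norm, norm_sub_rev]
      linarith
    have hnormal := hdeg z ⟨hz, hzU⟩ _ (mem_interiorNormals hxt hdz hpos)
    have hσv : (σ z)ᵀ *ᵥ v.ofLp = 0 := by
      rw [WithLp.ofLp_smul, Matrix.mulVec_smul] at hnormal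
      exact (smul_eq_zero.1 hnormal).resolve_left (inv_ne_zero hpos.ne')
    have hσB : ‖σ y - σ z‖ ≤ B * ‖y - z‖ := hσ y (subset_closure hy) z hz.1
    have hve : -inner ℝ v e ≤ B * ‖y - z‖ * ‖v‖ * W := by
      have e1 : -inner ℝ v e = inner ℝ (WithLp.toLp 2 (((σ y - σ z)ᵀ) *ᵥ v.ofLp))
          (WithLp.toLp 2 w : EuclideanSpace ℝ (Fin r)) := by
        rw [he, inner_neg_right, neg_neg, inner_eq_dotProduct, inner_eq_dotProduct,
          Matrix.transpose_sub, Matrix.sub_mulVec, hσv, sub_zero, Matrix.dotProduct_mulVec,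
          ← Matrix.mulVec_transpose]
      rw [e1]
      refine (real_inner_le_norm _ _).trans (mul_le_mul_of_nonneg_right ?_ hW0)
      refine (norm_toLp_mulVec_le _ _).trans ?_
      rw [Matrix.frobenius_norm_transpose]
      exact mul_le_mul_of_nonneg_right hσB (norm_nonneg _)
    -- `|v - t e| - |v|` is estimated by `(|v - t e| ^ 2 - |v| ^ 2) / (2 |v|)`.
    have hsq : ‖v - t • e‖ ^ 2 = ‖v‖ ^ 2 - 2 * (t * inner ℝ v e) + t ^ 2 * ‖e‖ ^ 2 := by
      rw [norm_sub_sq_real, inner_smul_right, hte, mul_pow]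
    have hdy_le : d y ≤ ‖v - t • e‖ := by
      rw [← hyz]
      exact bdrySignedDist_le hy hzΩ
    have hvpos : 0 < ‖v‖ := hpos
    have hv_ge : d y ≤ 2 * ‖v‖ := by rw [← hdz]; linarith
    have h4 : 2 * ‖v‖ * (d y - ‖v‖) ≤ 2 * t * (B * ‖y - z‖ * ‖v‖ * W) + t ^ 2 * ‖e‖ ^ 2 := by
      nlinarith [sq_nonneg (‖v - t • e‖ - ‖v‖), mul_le_mul_of_nonneg_left hve ht.le]
    have h5 : d y - ‖v‖ ≤ t * (B * ‖y - z‖ * W) + t ^ 2 * (‖e‖ ^ 2 / d y) := by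
      have h6 : t ^ 2 * ‖e‖ ^ 2 ≤ 2 * ‖v‖ * (t ^ 2 * (‖e‖ ^ 2 / d y)) := by
        have : ‖e‖ ^ 2 = d y * (‖e‖ ^ 2 / d y) := by field_simp
        calc t ^ 2 * ‖e‖ ^ 2 = d y * (t ^ 2 * (‖e‖ ^ 2 / d y)) := by rw [this]; field_simp
          _ ≤ 2 * ‖v‖ * (t ^ 2 * (‖e‖ ^ 2 / d y)) :=
            mul_le_mul_of_nonneg_right hv_ge (by positivity)
      refine le_of_mul_le_mul_left (a := 2 * ‖v‖) ?_ (by positivity)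
      linarith
    have h6 : t * (B * ‖y - z‖ * W) ≤ t * (B * (d y + 2 * (t * ‖e‖)) * W) :=
      mul_le_mul_of_nonneg_left (mul_le_mul_of_nonneg_right
        (mul_le_mul_of_nonneg_left hyz_le hB) hW0) ht.le
    rw [hte, inner_smul_right, hpe, WithLp.ofLp_smul, Matrix.mulVec_smul, dotProduct_smul,
      smul_dotProduct, smul_eq_mul, smul_eq_mul] at h1
    rw [hdz] at h1
    nlinarith
  rcases eq_or_lt_of_le hW0 with h0 | h0
  · rw [← h0]; positivity
  · refine le_of_mul_le_mul_right (a := W) ?_ h0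
    linarith

/-- An upper jet of `log g` gives an upper jet of `g`. -/
theorem UpperJet.of_log {g : EuclideanSpace ℝ (Fin n) → ℝ} {y q : EuclideanSpace ℝ (Fin n)}
    {Y : Matrix (Fin n) (Fin n) ℝ} (hg : ∀ᶠ x in 𝓝 y, 0 < g x)
    (h : UpperJet (fun x => Real.log (g x)) y q Y) :
    UpperJet g y (g y • q) (g y • (Y + Matrix.vecMulVec q.ofLp q.ofLp)) := by
  intro ε hε
  have hgy : 0 < g y := hg.self_of_nhds
  set ε' := ε / (2 * g y) with hε'
  have hε'0 : 0 < ε' := by positivity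
  set K := ‖q‖ + ‖Y‖ + ε' with hK
  have hK0 : 0 < K := by positivity
  have hlim : Tendsto (fun k : EuclideanSpace ℝ (Fin n) => y + k) (𝓝 0) (𝓝 y) := by
    have : Continuous fun k : EuclideanSpace ℝ (Fin n) => y + k := by fun_prop
    simpa using this.tendsto 0
  have hsmall : ∀ c > 0, ∀ C : ℝ, ∀ᶠ k : EuclideanSpace ℝ (Fin n) in 𝓝 0, C * ‖k‖ < c := by
    intro c hc C
    have : Continuous fun k : EuclideanSpace ℝ (Fin n) => C * ‖k‖ := by fun_prop
    exact (this.tendsto 0).eventually (gt_mem_nhds (by simpa using hc))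
  filter_upwards [h ε' hε'0, hlim.eventually hg, hsmall 1 one_pos 1, hsmall 1 one_pos K,
    hsmall ε' hε'0 (K ^ 2 + K ^ 3)] with k h1 h2 h3 h4 h5
  set a := inner ℝ q k with ha
  set Q := k.ofLp ⬝ᵥ (Y *ᵥ k.ofLp) with hQ
  set t := a + (1 / 2 : ℝ) * Q + ε' * ‖k‖ ^ 2 with ht
  have hk0 := norm_nonneg k
  have ha' : |a| ≤ ‖q‖ * ‖k‖ := abs_real_inner_le_norm q k
  have hQ' : |Q| ≤ ‖Y‖ * ‖k‖ ^ 2 := abs_dotProduct_mulVec_le Y k.ofLp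
  have hk1 : ‖k‖ ^ 2 ≤ ‖k‖ := by nlinarith
  have hta : |t - a| ≤ K * ‖k‖ ^ 2 := by
    rw [show t - a = (1 / 2 : ℝ) * Q + ε' * ‖k‖ ^ 2 by rw [ht]; ring]
    have h6 := abs_le.1 hQ'
    have h7 : 0 ≤ ‖q‖ * ‖k‖ ^ 2 := by positivity
    have h8 : 0 ≤ ‖Y‖ * ‖k‖ ^ 2 := by positivity
    have h9 : 0 ≤ ε' * ‖k‖ ^ 2 := by positivity
    rw [hK, abs_le]
    constructor <;> nlinarith [h6.1, h6.2]
  have haK : |a| ≤ K * ‖k‖ := by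
    refine ha'.trans (mul_le_mul_of_nonneg_right ?_ hk0)
    rw [hK]
    linarith [norm_nonneg Y]
  have htK : |t| ≤ K * ‖k‖ := by
    have h6 := abs_le.1 hQ'
    have h7 := abs_le.1 ha'
    have h8 : ‖Y‖ * ‖k‖ ^ 2 ≤ ‖Y‖ * ‖k‖ := mul_le_mul_of_nonneg_left hk1 (norm_nonneg _)
    have h9 : ε' * ‖k‖ ^ 2 ≤ ε' * ‖k‖ := mul_le_mul_of_nonneg_left hk1 hε'0.le
    have h10 : 0 ≤ ‖Y‖ * ‖k‖ := by positivity
    have h11 : 0 ≤ ε' * ‖k‖ ^ 2 := by positivity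
    rw [hK, abs_le]
    constructor <;> linarith
  have hexp : Real.exp t ≤ 1 + t + t ^ 2 / 2 + |t| ^ 3 := by
    have h6 := (abs_le.1 (Real.exp_bound (htK.trans h4.le) (n := 3) (by norm_num))).2
    have h7 : 0 ≤ |t| ^ 3 := by positivity
    norm_num [Finset.sum_range_succ, Nat.factorial] at h6
    linarith
  have hsq : t ^ 2 - a ^ 2 ≤ 2 * K ^ 2 * ‖k‖ ^ 3 := by
    calc t ^ 2 - a ^ 2 = (t - a) * (t + a) := by ring
      _ ≤ |t - a| * |t + a| := by rw [← abs_mul]; exact le_abs_self _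
      _ ≤ K * ‖k‖ ^ 2 * (2 * (K * ‖k‖)) :=
        mul_le_mul hta ((abs_add_le _ _).trans (by linarith)) (abs_nonneg _) (by positivity)
      _ = 2 * K ^ 2 * ‖k‖ ^ 3 := by ring
  have hcube : |t| ^ 3 ≤ K ^ 3 * ‖k‖ ^ 3 := by
    rw [← mul_pow]
    exact pow_le_pow_left₀ (abs_nonneg _) htK 3
  have hrem : (K ^ 2 + K ^ 3) * ‖k‖ ^ 3 ≤ ε' * ‖k‖ ^ 2 := by
    have := mul_le_mul_of_nonneg_right h5.le (sq_nonneg ‖k‖)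
    linarith [this, show (K ^ 2 + K ^ 3) * ‖k‖ * ‖k‖ ^ 2 = (K ^ 2 + K ^ 3) * ‖k‖ ^ 3 by ring]
  have hmain : Real.exp t ≤ 1 + a + (1 / 2 : ℝ) * (Q + a ^ 2) + 2 * ε' * ‖k‖ ^ 2 := by
    linarith
  have hgk : g (y + k) ≤ g y * Real.exp t := by
    rw [← Real.log_le_log_iff h2 (by positivity), Real.log_mul hgy.ne' (Real.exp_ne_zero _),
      Real.log_exp, ht]
    linarith
  refine hgk.trans ((mul_le_mul_of_nonneg_left hmain hgy.le).trans (le_of_eq ?_))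
  have e1 : k.ofLp ⬝ᵥ (Matrix.vecMulVec q.ofLp q.ofLp *ᵥ k.ofLp) = a ^ 2 := by
    rw [Matrix.vecMulVec_mulVec, ha, inner_eq_dotProduct]
    simp only [op_smul_eq_smul, dotProduct_smul, smul_eq_mul]
    rw [dotProduct_comm k.ofLp, sq]
  rw [inner_smul_left, Matrix.smul_mulVec, dotProduct_smul, Matrix.add_mulVec, dotProduct_add, e1,
    conj_trivial, smul_eq_mul, ← ha, ← hQ]
  rw [hε']
  field_simp

/-- Near the boundary `log d` is a strict subsolution: its upper jets satisfy
`b·q + tr (a Y) ≥ k / d - |σᵀ Dd| ^ 2 / d ^ 2 ≥ k / d - B ^ 2`. -/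
theorem log_dist_subsolution {r m : ℕ} (hΩ : IsOpen Ω) (hne : Ωᶜ.Nonempty)
    {U : Set (EuclideanSpace ℝ (Fin n))}
    {b : EuclideanSpace ℝ (Fin n) → EuclideanSpace ℝ (Fin m) → EuclideanSpace ℝ (Fin n)}
    {a : EuclideanSpace ℝ (Fin n) → EuclideanSpace ℝ (Fin m) → Matrix (Fin n) (Fin n) ℝ}
    {σ : EuclideanSpace ℝ (Fin n) → EuclideanSpace ℝ (Fin m) → Matrix (Fin n) (Fin r) ℝ}
    {α : EuclideanSpace ℝ (Fin m)} {B k : ℝ} (hB : 0 ≤ B)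
    (haσ : ∀ x ∈ closure Ω, a x α = σ x α * (σ x α)ᵀ)
    (hσ : ∀ x ∈ closure Ω, ∀ y ∈ closure Ω, ‖σ x α - σ y α‖ ≤ B * ‖x - y‖)
    (hdist : DistViscosityIneq Ω U b a α k) (hdeg : NormalDegeneracy Ω U σ α)
    {y : EuclideanSpace ℝ (Fin n)} (hy : y ∈ Ω)
    (hU : Metric.ball y (2 * bdrySignedDist Ω y) ⊆ U)
    (hk : bdrySignedDist Ω y * (B ^ 2 + 1) ≤ k)
    {q : EuclideanSpace ℝ (Fin n)} {Y : Matrix (Fin n) (Fin n) ℝ} (hY : Y.IsSymm)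
    (hjet : UpperJet (fun x => Real.log (bdrySignedDist Ω x)) y q Y) :
    1 ≤ inner ℝ (b y α) q + (σ y α * (σ y α)ᵀ * Y).trace := by
  have hpos : ∀ᶠ x in 𝓝 y, 0 < bdrySignedDist Ω x := by
    filter_upwards [hΩ.mem_nhds hy] with x hx
    rw [bdrySignedDist_of_mem hx]
    exact infDist_compl_pos hΩ hne hx
  set d := bdrySignedDist Ω y with hd
  have hd0 : 0 < d := hpos.self_of_nhds
  have hj := hjet.of_log hpos
  rw [← hd] at hj
  have hsymm : (d • (Y + Matrix.vecMulVec q.ofLp q.ofLp)).IsSymm := by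
    refine (hY.add ?_).smul d
    rw [Matrix.IsSymm, Matrix.transpose_vecMulVec]
  have hyU : y ∈ U := hU (Metric.mem_ball_self (by positivity))
  have h1 := hdist y ⟨hy, hyU⟩ _ _ (hj.mem_superjet hsymm (closure Ω))
  have h2 := norm_transpose_mulVec_le (σ := fun x => σ x α) hΩ hne hB hσ hdeg hy hU hj
  rw [linearPart, haσ y (subset_closure hy), inner_smul_right, Matrix.mul_smul, Matrix.trace_smul,
    mul_add, Matrix.trace_add, smul_eq_mul] at h1
  rw [← hd, WithLp.ofLp_smul, Matrix.mulVec_smul, WithLp.toLp_smul, norm_smul, Real.norm_eq_abs,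
    abs_of_pos hd0, mul_comm B d] at h2
  have h3 := le_of_mul_le_mul_left h2 hd0
  have h4 : (σ y α * (σ y α)ᵀ * Matrix.vecMulVec q.ofLp q.ofLp).trace =
      ‖WithLp.toLp 2 ((σ y α)ᵀ *ᵥ q.ofLp)‖ ^ 2 := by
    rw [Matrix.trace_mul_comm, trace_vecMulVec_mul, ← Matrix.mulVec_mulVec,
      Matrix.dotProduct_mulVec, ← Matrix.mulVec_transpose, dotProduct_self_eq_norm_sq]
  have h5 := pow_le_pow_left₀ (norm_nonneg _) h3 2
  rw [h4] at h1
  refine le_of_mul_le_mul_left (a := d) ?_ hd0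
  nlinarith [mul_le_mul_of_nonneg_left h5 hd0.le]

end Distance

/-! ### Subsolutions near the boundary -/

section Assembly
variable {n m r : ℕ}

theorem abs_trace_le (M : Matrix (Fin n) (Fin n) ℝ) : |M.trace| ≤ n * ‖M‖ := by
  have h : ∀ i, |M i i| ≤ ‖M‖ := by
    intro i
    have := abs_dotProduct_mulVec_le M (EuclideanSpace.single i (1 : ℝ)).ofLp
    rw [WithLp.toLp_ofLp, PiLp.norm_single] at this
    simpa using this
  refine (Finset.abs_sum_le_sum_abs _ _).trans ((Finset.sum_le_sum fun i _ => h i).trans ?_)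
  simp

/-- A viscosity subsolution of the Bellman equation is a subsolution of the linear equation for
every value of the control. -/
theorem IsViscositySubsolution.linearSubsolution {Ω V : Set (EuclideanSpace ℝ (Fin n))}
    {A : Set (EuclideanSpace ℝ (Fin m))}
    {b : EuclideanSpace ℝ (Fin n) → EuclideanSpace ℝ (Fin m) → EuclideanSpace ℝ (Fin n)}
    {a : EuclideanSpace ℝ (Fin n) → EuclideanSpace ℝ (Fin m) → Matrix (Fin n) (Fin n) ℝ}
    {σ : EuclideanSpace ℝ (Fin n) → EuclideanSpace ℝ (Fin m) → Matrix (Fin n) (Fin r) ℝ}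
    {u : EuclideanSpace ℝ (Fin n) → ℝ} (hu : IsViscositySubsolution Ω A b a u)
    (hb : ∃ C : ℝ, ∀ x ∈ closure Ω, ∀ α ∈ A, ‖b x α‖ ≤ C)
    (ha : ∃ C : ℝ, ∀ x ∈ closure Ω, ∀ α ∈ A, ‖a x α‖ ≤ C)
    (haσ : ∀ x ∈ closure Ω, ∀ α ∈ A, a x α = σ x α * (σ x α)ᵀ)
    (hV : V ⊆ Ω) {α : EuclideanSpace ℝ (Fin m)} (hα : α ∈ A) :
    LinearSubsolution V (fun x => b x α) (fun x => σ x α) 0 u := by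
  intro x hx p X hX hjet
  obtain ⟨Cb, hCb⟩ := hb
  obtain ⟨Ca, hCa⟩ := ha
  have hxc : x ∈ closure Ω := subset_closure (hV hx)
  have hbdd : BddAbove (range fun β : A =>
      linearPart b a (β : EuclideanSpace ℝ (Fin m)) x p X) := by
    refine ⟨Cb * ‖p‖ + n * (Ca * ‖X‖), ?_⟩
    rintro _ ⟨β, rfl⟩
    simp only [linearPart]
    have h1 := (abs_le.1 (abs_real_inner_le_norm (b x β) p)).1
    have h2 := (abs_le.1 (abs_trace_le (a x β * X))).1
    have h3 := mul_le_mul_of_nonneg_right (hCb x hxc β β.2) (norm_nonneg p)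
    have h4 : ‖a x β * X‖ ≤ Ca * ‖X‖ := (Matrix.frobenius_norm_mul _ _).trans
      (mul_le_mul_of_nonneg_right (hCa x hxc β β.2) (norm_nonneg X))
    have h5 := mul_le_mul_of_nonneg_left h4 (Nat.cast_nonneg (α := ℝ) n)
    linarith
  have h1 := hu.2 x (hV hx) p X (hjet.mem_superjet hX Ω)
  have h2 : linearPart b a α x p X ≤ bellman A b a x p X := le_ciSup hbdd ⟨α, hα⟩
  rw [linearPart, haσ x hxc α hα] at h2
  linarith

/-- Adding a small concave quadratic to a positive multiple of a strict subsolution `g` preserves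
strictness. -/
theorem LinearSubsolution.smul_sub_sq {V : Set (EuclideanSpace ℝ (Fin n))}
    {b : EuclideanSpace ℝ (Fin n) → EuclideanSpace ℝ (Fin n)}
    {σ : EuclideanSpace ℝ (Fin n) → Matrix (Fin n) (Fin r) ℝ}
    {g : EuclideanSpace ℝ (Fin n) → ℝ} {κ ε μ C : ℝ} (hg : LinearSubsolution V b σ κ g)
    (hε : 0 < ε) (hμ : 0 ≤ μ) (x₀ : EuclideanSpace ℝ (Fin n))
    (hC : ∀ x ∈ V, inner ℝ (b x) (x - x₀) + (σ x * (σ x)ᵀ).trace ≤ C) :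
    LinearSubsolution V b σ (ε * κ - 2 * μ * C) fun x => ε * g x - μ * ‖x - x₀‖ ^ 2 := by
  intro y hy p X hX hjet
  have hjet' : UpperJet g y (ε⁻¹ • (p + (2 * μ) • (y - x₀)))
      (ε⁻¹ • (X + (2 * μ) • (1 : Matrix (Fin n) (Fin n) ℝ))) := by
    intro η hη
    filter_upwards [hjet (ε * η) (by positivity)] with k hk
    rw [show y + k - x₀ = (y - x₀) + k by abel, norm_add_sq_real (y - x₀) k] at hk
    rw [inner_smul_left, Matrix.smul_mulVec, dotProduct_smul, inner_add_left, inner_smul_left,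
      Matrix.add_mulVec, dotProduct_add, Matrix.smul_mulVec, dotProduct_smul, Matrix.one_mulVec,
      dotProduct_self_eq_norm_sq, conj_trivial, conj_trivial, smul_eq_mul, smul_eq_mul]
    refine le_of_mul_le_mul_left ?_ hε
    have e : ε * (g y + ε⁻¹ * (inner ℝ p k + 2 * μ * inner ℝ (y - x₀) k) + 1 / 2 *
        (ε⁻¹ * (k.ofLp ⬝ᵥ X *ᵥ k.ofLp + 2 * μ * ‖WithLp.toLp 2 k.ofLp‖ ^ 2)) + η * ‖k‖ ^ 2) =
        ε * g y + (inner ℝ p k + 2 * μ * inner ℝ (y - x₀) k) + 1 / 2 *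
        (k.ofLp ⬝ᵥ X *ᵥ k.ofLp + 2 * μ * ‖k‖ ^ 2) + ε * η * ‖k‖ ^ 2 := by
      rw [WithLp.toLp_ofLp]
      field_simp
    rw [e]
    linarith
  have h1 := hg y hy _ _ ((hX.add (Matrix.isSymm_one.smul _)).smul _) hjet'
  simp only [inner_smul_right, inner_add_right, Matrix.mul_smul, Matrix.trace_smul, Matrix.mul_add,
    Matrix.trace_add, Matrix.mul_one, smul_eq_mul] at h1
  have h2 := mul_le_mul_of_nonneg_left h1 hε.le
  have e : ε * (ε⁻¹ * (inner ℝ (b y) p + 2 * μ * inner ℝ (b y) (y - x₀)) +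
      ε⁻¹ * ((σ y * (σ y)ᵀ * X).trace + 2 * μ * (σ y * (σ y)ᵀ).trace)) =
      (inner ℝ (b y) p + 2 * μ * inner ℝ (b y) (y - x₀)) +
      ((σ y * (σ y)ᵀ * X).trace + 2 * μ * (σ y * (σ y)ᵀ).trace) := by
    field_simp
  rw [e] at h2
  have h3 := mul_le_mul_of_nonneg_left (hC y hy) (show 0 ≤ 2 * μ by positivity)
  linarith

theorem abs_log_sub_log_le {c s t : ℝ} (hc : 0 < c) (hs : c ≤ s) (ht : c ≤ t) :
    |Real.log s - Real.log t| ≤ c⁻¹ * |s - t| := by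
  have key : ∀ s t : ℝ, c ≤ s → c ≤ t → Real.log s - Real.log t ≤ c⁻¹ * |s - t| := by
    intro s t hs ht
    have hs0 := hc.trans_le hs
    have ht0 := hc.trans_le ht
    rw [← Real.log_div hs0.ne' ht0.ne']
    calc Real.log (s / t) ≤ s / t - 1 := Real.log_le_sub_one_of_pos (by positivity)
      _ = t⁻¹ * (s - t) := by field_simp
      _ ≤ t⁻¹ * |s - t| := mul_le_mul_of_nonneg_left (le_abs_self _) (by positivity)
      _ ≤ c⁻¹ * |s - t| := by gcongr
  rw [abs_le]
  have h1 := key s t hs ht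
  have h2 := key t s ht hs
  rw [abs_sub_comm t s] at h2
  constructor <;> linarith

/-- Neighbourhoods of the boundary contain a uniform boundary layer. -/
theorem exists_layer_subset {Ω V : Set (EuclideanSpace ℝ (Fin n))} (hΩ : IsOpen Ω)
    (hbdd : Bornology.IsBounded Ω) (hne : Ωᶜ.Nonempty) (hV : IsOpen V) (hfV : frontier Ω ⊆ V) :
    ∃ δ > 0, ∀ x ∈ Ω, bdrySignedDist Ω x < δ → x ∈ V := by
  have hcomp : IsCompact (frontier Ω) :=
    hbdd.isCompact_closure.of_isClosed_subset isClosed_frontier frontier_subset_closure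
  obtain ⟨δ, hδ, hsub⟩ := hcomp.exists_thickening_subset_open hV hfV
  refine ⟨δ, hδ, fun x hx hxd => hsub ?_⟩
  obtain ⟨z, hz, hd, _⟩ := exists_nearest_frontier hΩ hne hx
  rw [Metric.mem_thickening_iff]
  exact ⟨z, hz, by rwa [dist_eq_norm, ← hd]⟩

theorem isCompact_dist_ge {Ω : Set (EuclideanSpace ℝ (Fin n))} (hbdd : Bornology.IsBounded Ω)
    {τ : ℝ} (hτ : 0 < τ) :
    {x | τ ≤ Metric.infDist x Ωᶜ} ⊆ Ω ∧ IsCompact {x | τ ≤ Metric.infDist x Ωᶜ} := by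
  have hsub : {x | τ ≤ Metric.infDist x Ωᶜ} ⊆ Ω := by
    intro x hx
    by_contra hxΩ
    have : Metric.infDist x Ωᶜ = 0 := Metric.infDist_zero_of_mem hxΩ
    have hx' : τ ≤ Metric.infDist x Ωᶜ := hx
    linarith
  refine ⟨hsub, Metric.isCompact_of_isClosed_isBounded ?_ (hbdd.subset hsub)⟩
  exact isClosed_le continuous_const (Metric.continuous_infDist_pt _)

theorem lipschitz_const_mul_log_sub_sq {Ω : Set (EuclideanSpace ℝ (Fin n))}
    {K : Set (EuclideanSpace ℝ (Fin n))}
    (hKΩ : K ⊆ Ω) {c ε μ ρ : ℝ} (hc : 0 < c) (hε : 0 ≤ ε) (hμ : 0 ≤ μ)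
    {x₀ : EuclideanSpace ℝ (Fin n)} (hρ : K ⊆ Metric.closedBall x₀ ρ)
    (hd : ∀ x ∈ K, c ≤ bdrySignedDist Ω x) :
    ∀ x ∈ K, ∀ y ∈ K, ‖(ε * Real.log (bdrySignedDist Ω x) - μ * ‖x - x₀‖ ^ 2)
      - (ε * Real.log (bdrySignedDist Ω y) - μ * ‖y - x₀‖ ^ 2)‖ ≤
        (ε * c⁻¹ + 2 * μ * ρ) * ‖x - y‖ := by
  intro x hx y hy
  have h1 := abs_log_sub_log_le hc (hd x hx) (hd y hy)
  have h2 : |bdrySignedDist Ω x - bdrySignedDist Ω y| ≤ ‖x - y‖ := by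
    have h3 := bdrySignedDist_sub_le (hKΩ hx) (hKΩ hy)
    have h4 := bdrySignedDist_sub_le (hKΩ hy) (hKΩ hx)
    rw [norm_sub_rev] at h4
    rw [abs_le]
    constructor <;> linarith
  have h3 : |Real.log (bdrySignedDist Ω x) - Real.log (bdrySignedDist Ω y)| ≤ c⁻¹ * ‖x - y‖ :=
    h1.trans (mul_le_mul_of_nonneg_left h2 (by positivity))
  have h4 : |‖x - x₀‖ ^ 2 - ‖y - x₀‖ ^ 2| ≤ 2 * ρ * ‖x - y‖ := by
    have h5 : |‖x - x₀‖ - ‖y - x₀‖| ≤ ‖x - y‖ := by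
      simpa using abs_norm_sub_norm_le (x - x₀) (y - x₀)
    have h6 := mem_closedBall_iff_norm.1 (hρ hx)
    have h7 := mem_closedBall_iff_norm.1 (hρ hy)
    rw [sq_sub_sq, abs_mul, abs_of_nonneg (by positivity)]
    exact mul_le_mul (by linarith) h5 (abs_nonneg _) (by linarith [norm_nonneg (x - x₀)])
  rw [show (ε * Real.log (bdrySignedDist Ω x) - μ * ‖x - x₀‖ ^ 2)
      - (ε * Real.log (bdrySignedDist Ω y) - μ * ‖y - x₀‖ ^ 2) =
      ε * (Real.log (bdrySignedDist Ω x) - Real.log (bdrySignedDist Ω y))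
        - μ * (‖x - x₀‖ ^ 2 - ‖y - x₀‖ ^ 2) by ring]
  refine (norm_sub_le _ _).trans ?_
  rw [norm_mul, norm_mul, Real.norm_eq_abs, Real.norm_eq_abs, Real.norm_eq_abs, Real.norm_eq_abs,
    abs_of_nonneg hε, abs_of_nonneg hμ]
  nlinarith [mul_le_mul_of_nonneg_left h3 hε, mul_le_mul_of_nonneg_left h4 hμ]

/-- The growth condition at the boundary in quantitative form. -/
theorem exists_layer_growth {Ω : Set (EuclideanSpace ℝ (Fin n))} (hΩ : IsOpen Ω)
    (hbdd : Bornology.IsBounded Ω) (hne : Ωᶜ.Nonempty) {u : EuclideanSpace ℝ (Fin n) → ℝ}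
    (hu : limsup (fun x => ((u x / (-Real.log (bdrySignedDist Ω x)) : ℝ) : EReal))
      (𝓝ˢ (frontier Ω) ⊓ 𝓟 Ω) ≤ 0) {ε : ℝ} (hε : 0 < ε) :
    ∃ δ > 0, ∀ x ∈ Ω, bdrySignedDist Ω x < δ → u x ≤ ε * -Real.log (bdrySignedDist Ω x) := by
  have h1 : ∀ᶠ x in 𝓝ˢ (frontier Ω) ⊓ 𝓟 Ω,
      ((u x / (-Real.log (bdrySignedDist Ω x)) : ℝ) : EReal) < (ε : EReal) :=
    eventually_lt_of_limsup_lt (lt_of_le_of_lt hu (by exact_mod_cast hε))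
  rw [eventually_inf_principal] at h1
  obtain ⟨V, hV, hfV, hVu⟩ := mem_nhdsSet_iff_exists.1 h1
  obtain ⟨δ, hδ, hsub⟩ := exists_layer_subset hΩ hbdd hne hV hfV
  refine ⟨min δ 1, lt_min hδ one_pos, fun x hx hxd => ?_⟩
  have h2 : u x / (-Real.log (bdrySignedDist Ω x)) < ε :=
    EReal.coe_lt_coe_iff.1 (hVu (hsub x hx (hxd.trans_le (min_le_left _ _))) hx)
  have hd0 : 0 < bdrySignedDist Ω x := by
    rw [bdrySignedDist_of_mem hx]; exact infDist_compl_pos hΩ hne hx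
  have hlog := Real.log_neg hd0 (hxd.trans_le (min_le_right _ _))
  rw [div_lt_iff₀ (by linarith)] at h2
  exact h2.le

/-- In a layer around the boundary, every point has a neighbourhood in which `log d` is a strict
subsolution of the linear equation for one value of the control. -/
theorem exists_layer_log_subsolution {Ω : Set (EuclideanSpace ℝ (Fin n))} (hΩ : IsOpen Ω)
    (hbdd : Bornology.IsBounded Ω) (hne : Ωᶜ.Nonempty) {A : Set (EuclideanSpace ℝ (Fin m))}
    {b : EuclideanSpace ℝ (Fin n) → EuclideanSpace ℝ (Fin m) → EuclideanSpace ℝ (Fin n)}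
    {a : EuclideanSpace ℝ (Fin n) → EuclideanSpace ℝ (Fin m) → Matrix (Fin n) (Fin n) ℝ}
    {σ : EuclideanSpace ℝ (Fin n) → EuclideanSpace ℝ (Fin m) → Matrix (Fin n) (Fin r) ℝ}
    (haσ : ∀ x ∈ closure Ω, ∀ α ∈ A, a x α = σ x α * (σ x α)ᵀ)
    (hσ : ∃ B : ℝ, 0 < B ∧ ∀ x ∈ closure Ω, ∀ y ∈ closure Ω, ∀ α ∈ A,
      ‖σ x α - σ y α‖ ≤ B * ‖x - y‖)
    (h_bdry : ∀ z ∈ frontier Ω, ∃ α ∈ A, ∃ U ∈ 𝓝 z, ∃ k : ℝ, 0 < k ∧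
      DistViscosityIneq Ω U b a α k ∧ NormalDegeneracy Ω U σ α) :
    ∃ δ > 0, ∀ x ∈ Ω, bdrySignedDist Ω x < δ → ∃ α ∈ A, ∃ W ∈ 𝓝 x,
      LinearSubsolution (W ∩ Ω) (fun x => b x α) (fun x => σ x α) 1
        fun x => Real.log (bdrySignedDist Ω x) := by
  obtain ⟨B, hB, hσB⟩ := hσ
  have hloc : ∀ z ∈ frontier Ω, ∃ α ∈ A, ∃ ρ > 0,
      LinearSubsolution (Metric.ball z ρ ∩ Ω) (fun x => b x α) (fun x => σ x α) 1
        fun x => Real.log (bdrySignedDist Ω x) := by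
    intro z hz
    obtain ⟨α, hα, U, hU, k, hk, hdist, hdeg⟩ := h_bdry z hz
    obtain ⟨R, hR, hRU⟩ := Metric.mem_nhds_iff.1 hU
    refine ⟨α, hα, min (R / 3) (k / (B ^ 2 + 1)), lt_min (by positivity) (by positivity), ?_⟩
    rintro y ⟨hyz, hy⟩ q Y hY hjet
    rw [mem_ball_iff_norm, lt_min_iff] at hyz
    have hzΩ : z ∉ Ω := by
      have := hz.2
      rwa [hΩ.interior_eq] at this
    have hdz := bdrySignedDist_le hy hzΩ
    refine log_dist_subsolution hΩ hne hB.le (fun x hx => haσ x hx α hα)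
      (fun x hx y hy => hσB x hx y hy α hα) hdist hdeg hy ?_ ?_ hY hjet
    · refine (Metric.ball_subset_ball' ?_).trans hRU
      rw [dist_eq_norm]
      linarith [hyz.1]
    · rw [← le_div_iff₀ (by positivity)]
      linarith [hyz.2]
  choose! α hα ρ hρ hsub using hloc
  obtain ⟨δ, hδ, hδV⟩ := exists_layer_subset hΩ hbdd hne
    (V := ⋃ z ∈ frontier Ω, Metric.ball z (ρ z))
    (isOpen_biUnion fun _ _ => Metric.isOpen_ball)
    (fun z hz => mem_biUnion hz (Metric.mem_ball_self (hρ z hz)))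
  refine ⟨δ, hδ, fun x hx hxd => ?_⟩
  obtain ⟨z, hz, hxz⟩ := mem_iUnion₂.1 (hδV x hx hxd)
  exact ⟨α z, hα z hz, Metric.ball z (ρ z), Metric.isOpen_ball.mem_nhds hxz, hsub z hz⟩

end Assembly

/-! ### Reduction to the strong maximum principle -/

section Maximum
variable {n m r : ℕ}

/-- If a subsolution exceeds its maximum over `{d ≥ δ}` somewhere in the boundary layer, then
`u + ε log d` has, for small `ε`, a maximum over the layer at an interior point of it. -/
theorem exists_interior_max_add_log {Ω : Set (EuclideanSpace ℝ (Fin n))} (hΩ : IsOpen Ω)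
    (hbdd : Bornology.IsBounded Ω) (hne : Ωᶜ.Nonempty) {u : EuclideanSpace ℝ (Fin n) → ℝ}
    (hu : UpperSemicontinuousOn u Ω)
    (hgrowth : limsup (fun x => ((u x / (-Real.log (bdrySignedDist Ω x)) : ℝ) : EReal))
      (𝓝ˢ (frontier Ω) ⊓ 𝓟 Ω) ≤ 0) {δ c : ℝ}
    (hc : ∀ x ∈ Ω, δ ≤ bdrySignedDist Ω x → u x ≤ c)
    {x₁ : EuclideanSpace ℝ (Fin n)} (hx₁ : x₁ ∈ Ω) (hux₁ : c < u x₁) :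
    ∃ ε > 0, ∃ x₀ ∈ Ω, bdrySignedDist Ω x₀ < δ ∧ ∀ x ∈ Ω, bdrySignedDist Ω x < δ →
      u x + ε * Real.log (bdrySignedDist Ω x) ≤ u x₀ + ε * Real.log (bdrySignedDist Ω x₀) := by
  have hd : ∀ x ∈ Ω, bdrySignedDist Ω x = Metric.infDist x Ωᶜ := fun x hx =>
    bdrySignedDist_of_mem hx
  have hpos : ∀ x ∈ Ω, 0 < bdrySignedDist Ω x := fun x hx => by
    rw [hd x hx]; exact infDist_compl_pos hΩ hne hx
  have hx₁δ : bdrySignedDist Ω x₁ < δ := by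
    by_contra! h
    linarith [hc x₁ hx₁ h]
  have hlog : Real.log (bdrySignedDist Ω x₁) < Real.log δ := Real.log_lt_log (hpos x₁ hx₁) hx₁δ
  set s := Real.log δ - Real.log (bdrySignedDist Ω x₁) with hs
  have hs0 : 0 < s := by linarith
  -- With this `ε` half of the excess `u x₁ - c` is left after adding `ε log (d / δ)`.
  set ε := (u x₁ - c) / (2 * s) with hε
  have hε0 : 0 < ε := div_pos (by linarith) (by positivity)
  have hεs : ε * s = (u x₁ - c) / 2 := by rw [hε]; field_simp
  set g : EuclideanSpace ℝ (Fin n) → ℝ := fun x => u x + ε * Real.log (bdrySignedDist Ω x) with hg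
  have hgx₁ : c + ε * Real.log δ < g x₁ := by
    have : ε * Real.log δ - ε * Real.log (bdrySignedDist Ω x₁) = (u x₁ - c) / 2 := by
      rw [← hεs, hs]; ring
    simp only [hg]
    linarith
  obtain ⟨δ', hδ', hδu⟩ := exists_layer_growth hΩ hbdd hne hgrowth (half_pos hε0)
  -- Below the level `τ` the function `g ≤ (ε / 2) log d` is smaller than its value at `x₁`.
  obtain ⟨τ, hτ, hτδ', hτx₁, hτg⟩ : ∃ τ > 0, τ ≤ δ' ∧ τ ≤ bdrySignedDist Ω x₁ ∧
      ε / 2 * Real.log τ ≤ g x₁ := by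
    refine ⟨min (min δ' (bdrySignedDist Ω x₁)) (Real.exp (g x₁ / (ε / 2))),
      lt_min (lt_min hδ' (hpos x₁ hx₁)) (Real.exp_pos _),
      (min_le_left _ _).trans (min_le_left _ _), (min_le_left _ _).trans (min_le_right _ _), ?_⟩
    have h1 := Real.log_le_log (lt_min (lt_min hδ' (hpos x₁ hx₁)) (Real.exp_pos _))
      (min_le_right (min δ' (bdrySignedDist Ω x₁)) (Real.exp (g x₁ / (ε / 2))))
    rw [Real.log_exp, le_div_iff₀ (half_pos hε0)] at h1
    linarith
  obtain ⟨hKΩ, hK⟩ := isCompact_dist_ge hbdd hτ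
  have hK' : IsCompact ({x | τ ≤ Metric.infDist x Ωᶜ} ∩ {x | Metric.infDist x Ωᶜ ≤ δ}) :=
    hK.inter_right (isClosed_le (Metric.continuous_infDist_pt _) continuous_const)
  set K := {x | τ ≤ Metric.infDist x Ωᶜ} ∩ {x | Metric.infDist x Ωᶜ ≤ δ} with hKdef
  have hKΩ' : K ⊆ Ω := inter_subset_left.trans hKΩ
  have hx₁K : x₁ ∈ K := by
    refine ⟨?_, ?_⟩
    · rw [mem_ofPred_eq, ← hd x₁ hx₁]; exact hτx₁
    · rw [mem_ofPred_eq, ← hd x₁ hx₁]; exact hx₁δ.le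
  have hlogc : ContinuousOn (fun x => ε * Real.log (bdrySignedDist Ω x)) K := by
    have h1 : ContinuousOn (fun x => ε * Real.log (Metric.infDist x Ωᶜ)) K :=
      continuousOn_const.mul ((Metric.continuous_infDist_pt _).continuousOn.log fun x hx =>
        (infDist_compl_pos hΩ hne (hKΩ' hx)).ne')
    exact h1.congr fun x hx => by rw [hd x (hKΩ' hx)]
  obtain ⟨x₀, hx₀, hmax⟩ := UpperSemicontinuousOn.exists_isMaxOn ⟨x₁, hx₁K⟩ hK'
    ((hu.mono hKΩ').add hlogc.upperSemicontinuousOn)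
  have hx₀Ω := hKΩ' hx₀
  have hgx₀ : g x₁ ≤ g x₀ := hmax hx₁K
  refine ⟨ε, hε0, x₀, hx₀Ω, ?_, fun x hx hxδ => ?_⟩
  · by_contra! h
    have h1 := hc x₀ hx₀Ω h
    have h2 : bdrySignedDist Ω x₀ ≤ δ := by rw [hd x₀ hx₀Ω]; exact hx₀.2
    have h3 := mul_le_mul_of_nonneg_left (Real.log_le_log (hpos x₀ hx₀Ω) h2) hε0.le
    simp only [hg] at hgx₀ hgx₁
    linarith
  · rcases le_or_gt τ (bdrySignedDist Ω x) with h | h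
    · refine hmax (show x ∈ K from ⟨?_, ?_⟩)
      · rw [mem_ofPred_eq, ← hd x hx]; exact h
      · rw [mem_ofPred_eq, ← hd x hx]; exact hxδ.le
    · have h1 := hδu x hx (h.trans_le hτδ')
      have h2 := mul_le_mul_of_nonneg_left (Real.log_le_log (hpos x hx) h.le) (half_pos hε0).le
      change g x ≤ g x₀
      refine le_trans ?_ (hτg.trans hgx₀)
      simp only [hg]
      linarith

end Maximum

theorem mainTheorem8 {n m r : ℕ}
    (Ω : Set (EuclideanSpace ℝ (Fin n)))
    (hΩ_open : IsOpen Ω) (hΩ_bdd : Bornology.IsBounded Ω) (hΩ_conn : IsConnected Ω)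
    (A : Set (EuclideanSpace ℝ (Fin m))) (hA : IsClosed A)
    (b : EuclideanSpace ℝ (Fin n) → EuclideanSpace ℝ (Fin m) → EuclideanSpace ℝ (Fin n))
    (a : EuclideanSpace ℝ (Fin n) → EuclideanSpace ℝ (Fin m) → Matrix (Fin n) (Fin n) ℝ)
    (σ : EuclideanSpace ℝ (Fin n) → EuclideanSpace ℝ (Fin m) → Matrix (Fin n) (Fin r) ℝ)
    (hb_cont : ContinuousOn (Function.uncurry b) (closure Ω ×ˢ A))
    (ha_cont : ContinuousOn (Function.uncurry a) (closure Ω ×ˢ A))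
    (hb_bdd : ∃ C : ℝ, ∀ x ∈ closure Ω, ∀ α ∈ A, ‖b x α‖ ≤ C)
    (ha_bdd : ∃ C : ℝ, ∀ x ∈ closure Ω, ∀ α ∈ A, ‖a x α‖ ≤ C)
    (haσ : ∀ x ∈ closure Ω, ∀ α ∈ A, a x α = σ x α * (σ x α)ᵀ)
    (hb_lip : ∃ B : ℝ, 0 < B ∧ ∀ x ∈ closure Ω, ∀ y ∈ closure Ω, ∀ α ∈ A,
      ‖b x α - b y α‖ ≤ B * ‖x - y‖)
    (hσ_lip : ∃ B : ℝ, 0 < B ∧ ∀ x ∈ closure Ω, ∀ y ∈ closure Ω, ∀ α ∈ A,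
      ‖σ x α - σ y α‖ ≤ B * ‖x - y‖)
    (h_bdry : ∀ z ∈ frontier Ω, ∃ α ∈ A, ∃ U ∈ 𝓝 z, ∃ k : ℝ, 0 < k ∧
      DistViscosityIneq Ω U b a α k ∧ NormalDegeneracy Ω U σ α)
    (hSMP : StrongMaximumPrinciple Ω A b a)
    (u : EuclideanSpace ℝ (Fin n) → ℝ)
    (hu : IsViscositySubsolution Ω A b a u)
    (hu_growth : limsup (fun x => ((u x / (-Real.log (bdrySignedDist Ω x)) : ℝ) : EReal))
      (𝓝ˢ (frontier Ω) ⊓ 𝓟 Ω) ≤ 0) :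
    ∃ c : ℝ, ∀ x ∈ Ω, u x = c := by
  rcases Nat.eq_zero_or_pos n with rfl | hn
  · exact ⟨u 0, fun x _ => by rw [Subsingleton.elim x 0]⟩
  have : NeZero n := ⟨hn.ne'⟩
  have hne : Ωᶜ.Nonempty := by
    rw [nonempty_compl]
    rintro rfl
    exact NormedSpace.unbounded_univ ℝ _ hΩ_bdd
  obtain ⟨δ₀, hδ₀, hsub⟩ := exists_layer_log_subsolution hΩ_open hΩ_bdd hne haσ hσ_lip h_bdry
  obtain ⟨x₂, hx₂⟩ := hΩ_conn.nonempty
  have hpos : ∀ x ∈ Ω, 0 < bdrySignedDist Ω x := fun x hx => by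
    rw [bdrySignedDist_of_mem hx]; exact infDist_compl_pos hΩ_open hne hx
  obtain ⟨δ, hδ, hδδ₀, hδx₂⟩ : ∃ δ > 0, δ ≤ δ₀ ∧ δ ≤ bdrySignedDist Ω x₂ :=
    ⟨min δ₀ (bdrySignedDist Ω x₂), lt_min hδ₀ (hpos x₂ hx₂), min_le_left _ _, min_le_right _ _⟩
  obtain ⟨hKΩ, hK⟩ := isCompact_dist_ge hΩ_bdd hδ
  obtain ⟨xm, hxm, hmax⟩ := UpperSemicontinuousOn.exists_isMaxOn
    ⟨x₂, show δ ≤ Metric.infDist x₂ Ωᶜ by rwa [← bdrySignedDist_of_mem hx₂]⟩ hK (hu.1.mono hKΩ)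
  refine hSMP u hu ⟨xm, hKΩ hxm, fun x₁ hx₁ => ?_⟩
  by_contra hlt
  have hlt' : u xm < u x₁ := not_le.1 hlt
  obtain ⟨ε, hε, x₀, hx₀, hx₀δ, hx₀max⟩ := exists_interior_max_add_log hΩ_open hΩ_bdd hne hu.1
    hu_growth (c := u xm)
    (fun x hx hxd => hmax (show δ ≤ Metric.infDist x Ωᶜ by rwa [← bdrySignedDist_of_mem hx]))
    hx₁ hlt'
  obtain ⟨α, hα, W, hW, hlogW⟩ := hsub x₀ hx₀ (hx₀δ.trans_le hδδ₀)
  -- A closed ball around `x₀` inside the layer, in which `log d` is a strict subsolution.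
  have hlayer : ∀ᶠ x in 𝓝 x₀, x ∈ W ∧ x ∈ Ω ∧
      bdrySignedDist Ω x₀ / 2 < Metric.infDist x Ωᶜ ∧ Metric.infDist x Ωᶜ < δ := by
    have hcont := (Metric.continuous_infDist_pt (Ωᶜ)).tendsto x₀
    rw [← bdrySignedDist_of_mem hx₀] at hcont
    filter_upwards [hW, hΩ_open.mem_nhds hx₀,
      hcont.eventually (lt_mem_nhds (half_lt_self (hpos x₀ hx₀))),
      hcont.eventually (gt_mem_nhds hx₀δ)] with x h1 h2 h3 h4
    exact ⟨h1, h2, h3, h4⟩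
  obtain ⟨ρ, hρ, hball⟩ := Metric.nhds_basis_closedBall.mem_iff.1 hlayer
  have hBΩ : Metric.closedBall x₀ ρ ⊆ Ω := fun x hx => (hball hx).2.1
  have hBc : ∀ x ∈ Metric.closedBall x₀ ρ, x ∈ closure Ω := fun x hx => subset_closure (hBΩ hx)
  have hlog : LinearSubsolution (Metric.ball x₀ ρ) (fun x => b x α) (fun x => σ x α) 1
      fun x => Real.log (bdrySignedDist Ω x) := fun x hx =>
    have hx' := hball (Metric.ball_subset_closedBall hx)
    hlogW x ⟨hx'.1, hx'.2.1⟩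
  obtain ⟨Cb, hCb⟩ := hb_bdd
  obtain ⟨Ca, hCa⟩ := ha_bdd
  obtain ⟨B₁, hB₁, hb_lip⟩ := hb_lip
  obtain ⟨B₂, hB₂, hσ_lip⟩ := hσ_lip
  have hC : ∀ x ∈ Metric.ball x₀ ρ,
      inner ℝ (b x α) (x - x₀) + (σ x α * (σ x α)ᵀ).trace ≤ |Cb| * ρ + n * |Ca| := by
    intro x hx
    have hxc := hBc x (Metric.ball_subset_closedBall hx)
    rw [← haσ x hxc α hα]
    refine add_le_add ((real_inner_le_norm _ _).trans ?_)
      ((le_abs_self _).trans ((abs_trace_le _).trans ?_))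
    · exact mul_le_mul ((hCb x hxc α hα).trans (le_abs_self _)) (mem_ball_iff_norm.1 hx).le
        (norm_nonneg _) (abs_nonneg _)
    · exact mul_le_mul_of_nonneg_left ((hCa x hxc α hα).trans (le_abs_self _)) (Nat.cast_nonneg _)
  set C := |Cb| * ρ + n * |Ca| with hCdef
  have hC0 : 0 ≤ C := by positivity
  -- The constant `μ` is so small that the quadratic perturbation keeps the subsolution strict.
  obtain ⟨μ, hμ, hμC⟩ : ∃ μ > 0, 2 * μ * C < ε := by
    refine ⟨ε / (2 * C + 1), by positivity, ?_⟩
    rw [show 2 * (ε / (2 * C + 1)) * C = ε * (2 * C) / (2 * C + 1) by ring,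
      div_lt_iff₀ (by positivity)]
    nlinarith
  refine LinearSubsolution.not_strict_max (r := r) (f₁ := u)
    (f₂ := fun x => ε * Real.log (bdrySignedDist Ω x) - μ * ‖x - x₀‖ ^ 2) hρ (hu.1.mono hBΩ)
    (show 0 ≤ ε * (bdrySignedDist Ω x₀ / 2)⁻¹ + 2 * μ * ρ by
      have := hpos x₀ hx₀
      positivity)
    (lipschitz_const_mul_log_sub_sq hBΩ (half_pos (hpos x₀ hx₀)) hε.le hμ.le subset_rfl
      fun x hx => by rw [bdrySignedDist_of_mem (hBΩ hx)]; exact (hball hx).2.2.1.le)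
    (hu.linearSubsolution ⟨Cb, hCb⟩ ⟨Ca, hCa⟩ haσ (Metric.ball_subset_closedBall.trans hBΩ) hα)
    (hlog.smul_sub_sq hε hμ.le x₀ hC) (by linarith)
    (fun x hx y hy => hb_lip x (hBc x hx) y (hBc y hy) α hα)
    (fun x hx y hy => hσ_lip x (hBc x hx) y (hBc y hy) α hα) hμ ?_
  intro x hx
  have h1 := hx₀max x (hBΩ hx) (by rw [bdrySignedDist_of_mem (hBΩ hx)]; exact (hball hx).2.2.2)
  simp only [sub_self, norm_zero]
  linarith
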